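/- Let $\mathbb D=\{z\in\mathbb C:|z|<1\}$ and let $dA$ be Lebesgue area measure on $\mathbb D$ divided by $\pi$. For $p>2$ let $A^p$ be the Bergman space of all analytic functions $f$ on $\mathbb D$ with $\|f\|_{A^p}=\bigl(\int_{\mathbb D}|f(z)|^p\,dA(z)\bigr)^{1/p}<\infty$. The Hilbert matrix operator $\mathcal H$ sends $f(z)=\sum_{k=0}^\infty a_kz^k$ to $$\mathcal H(f)(z)=\sum_{n=0}^\infty\Bigl(\sum_{k=0}^\infty\frac{a_k}{n+k+1}\Bigr)z^n .$$ **Theorem.** Let $2<p<4$. Then for every $f\in A^p$ the series $\sum_{k}a_k/(n+k+1)$ converges absolutely for every $n\ge 0$, the power series defining $\mathcal H(f)(z)$ converges absolutely for every $z\in\mathbb D$, and $\mathcal H(f)\in A^p$. Moreover, the norm of $\mathcal H\colon A^p\to A^p$, that is, the least constant $C\ge 0$ such that $\|\mathcal H(f)\|_{A^p}\le C\|f\|_{A^p}$ for all $f\in A^p$, is $$\|\mathcal H\|_{A^p\to A^p}=\frac{\pi}{\sin(2\pi/p)}.$$ -/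

import Mathlib

open scoped Nat

noncomputable section

/-- The open unit disc of the complex plane. -/
def disc : Set ℂ := Metric.ball (0 : ℂ) 1

/-- Membership in the Bergman space `A^p`: analytic in the open unit disc, with `|f|^p` integrable
over the disc. Only the values of `f` on the disc matter. -/
def MemBergman (p : ℝ) (f : ℂ → ℂ) : Prop :=
  AnalyticOnNhd ℂ f disc ∧ MeasureTheory.IntegrableOn (fun z => ‖f z‖ ^ p) disc

/-- The norm of `A^p`: `(∫_𝔻 |f|^p dA)^(1/p)`, where `dA` is area measure divided by `π`. -/
def bergmanNorm (p : ℝ) (f : ℂ → ℂ) : ℝ :=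
  (Real.pi⁻¹ * ∫ z in disc, ‖f z‖ ^ p) ^ (1 / p)

/-- The `k`-th Taylor coefficient of `f` at the origin. -/
def taylorCoeff (f : ℂ → ℂ) (k : ℕ) : ℂ :=
  iteratedDeriv k f 0 / (k ! : ℂ)

/-- The `n`-th coefficient `∑ₖ aₖ / (n + k + 1)` of the image of `f = ∑ₖ aₖ zᵏ` under the Hilbert
matrix. It is meaningful when the series is summable. -/
def hilbertCoeff (f : ℂ → ℂ) (n : ℕ) : ℂ :=
  ∑' k : ℕ, taylorCoeff f k / ((n : ℂ) + (k : ℂ) + 1)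

/-- The Hilbert matrix operator, acting on Taylor coefficients. -/
def hilbertOp (f : ℂ → ℂ) (z : ℂ) : ℂ :=
  ∑' n : ℕ, hilbertCoeff f n * z ^ n

end

open scoped ENNReal
open MeasureTheory Set Filter Topology

/-! ### Beta integrals -/

/-! Put α = 2/p and B = π / sin(πα), the total mass of t^(α-1) (1-t)^(-α) on (0,1). Summing
1/(n+k+1) = ∫ t^(n+k) dt and deforming the path of integration exhibits the operator as the average
over t in (0,1) of f ↦ w_t · (f ∘ φ_t), with w_t(z) = 1/((t-1)z+1) and φ_t = t w_t
(`hilbertOp_eq_integral`).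

Upper bound: Hölder's inequality with density `betaWeight α`, then the substitution w = φ_t(z),
bound the p-th power integral of the image by B^(p-1) ∫ r^(p-3) G(r) M(r) dr. Here M is the circle
mean of |f|^p, and G = `cumBeta α` collects only the t with t/(2-t) < r, since φ_t omits the disc
|w| ≤ t/(2-t). For p < 4 the factor |w|^(p-4) produced by the substitution exceeds 1, and this loss
must be recovered from the omitted disc and from the growth of M. What is needed is ∫ r^(p-3) G M ≤
B ∫ r M (`lintegral_rpow_mul_cumBeta_mul_le`). If 4-p ≤ α the kernels compare pointwise. Otherwise
the kernel r^(p-3) G exceeds B r only to the left of a crossing point (`cumBeta_le_of_le`), its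
total mass is no larger (`lintegral_rpow_mul_cumBeta_le`), and M increases (`circleMean_mono`), so a
Chebyshev argument applies.

Lower bound: (1-z)^(-γ) is mapped to itself times a factor tending to B as γ ↑ α and z → 1
(`hilbertOp_powTest`, `tendsto_powFactor`). The p-th power mass of these functions blows up and
concentrates at z = 1, so no constant below B can serve. -/

theorem integrableOn_rpow_mul_one_sub_rpow {u v : ℝ} (hu : 0 < u) (hv : 0 < v) :
    IntegrableOn (fun t : ℝ => t ^ (u - 1) * (1 - t) ^ (v - 1)) (Ioo 0 1) := by
  have h := Complex.betaIntegral_convergent (u := u) (v := v) (by simpa) (by simpa)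
  rw [intervalIntegrable_iff_integrableOn_Ioo_of_le zero_le_one] at h
  have h' : IntegrableOn _ (Ioo (0 : ℝ) 1) := h.re
  refine h'.congr_fun (fun t ht => ?_) measurableSet_Ioo
  have h1 : (t : ℂ) ^ ((u : ℂ) - 1) = ((t ^ (u - 1) : ℝ) : ℂ) := by
    rw [Complex.ofReal_cpow ht.1.le]; push_cast; rfl
  have h2 : (1 - (t : ℂ)) ^ ((v : ℂ) - 1) = (((1 - t) ^ (v - 1) : ℝ) : ℂ) := by
    rw [Complex.ofReal_cpow (by linarith [ht.2])]; push_cast; rfl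
  simp only [h1, h2, ← Complex.ofReal_mul]
  exact Complex.ofReal_re _

theorem integral_rpow_mul_one_sub_rpow {u v : ℝ} (hu : 0 < u) (hv : 0 < v) :
    ∫ t in Ioo (0 : ℝ) 1, t ^ (u - 1) * (1 - t) ^ (v - 1) =
      Real.Gamma u * Real.Gamma v / Real.Gamma (u + v) := by
  have h := Complex.betaIntegral_eq_Gamma_mul_div u v (by simpa) (by simpa)
  rw [Complex.betaIntegral, intervalIntegral.integral_of_le zero_le_one,
    integral_Ioc_eq_integral_Ioo] at h
  have e : ∫ t in Ioo (0 : ℝ) 1, (t : ℂ) ^ ((u : ℂ) - 1) * (1 - (t : ℂ)) ^ ((v : ℂ) - 1) =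
      ∫ t in Ioo (0 : ℝ) 1, ((t ^ (u - 1) * (1 - t) ^ (v - 1) : ℝ) : ℂ) := by
    refine setIntegral_congr_fun measurableSet_Ioo fun t ht => ?_
    have h1 : (t : ℂ) ^ ((u : ℂ) - 1) = ((t ^ (u - 1) : ℝ) : ℂ) := by
      rw [Complex.ofReal_cpow ht.1.le]; push_cast; rfl
    have h2 : (1 - (t : ℂ)) ^ ((v : ℂ) - 1) = (((1 - t) ^ (v - 1) : ℝ) : ℂ) := by
      rw [Complex.ofReal_cpow (by linarith [ht.2])]; push_cast; rfl
    simp only [h1, h2, ← Complex.ofReal_mul]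
  rw [e, integral_complex_ofReal, Complex.Gamma_ofReal, Complex.Gamma_ofReal, ← Complex.ofReal_add,
    Complex.Gamma_ofReal] at h
  exact_mod_cast h

/-- The weight `t ^ (α - 1) (1 - t) ^ (-α)` on `(0, 1)`. -/
noncomputable def betaWeight (α t : ℝ) : ℝ := t ^ (α - 1) * (1 - t) ^ (-α)

/-- The total mass `π / sin (π α)` of the weight `betaWeight α`. -/
noncomputable def betaMass (α : ℝ) : ℝ := Real.pi / Real.sin (Real.pi * α)

theorem betaWeight_pos {α t : ℝ} (h0 : 0 < t) (h1 : t < 1) : 0 < betaWeight α t :=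
  mul_pos (Real.rpow_pos_of_pos h0 _) (Real.rpow_pos_of_pos (by linarith) _)

theorem measurable_betaWeight (α : ℝ) : Measurable (betaWeight α) := by
  unfold betaWeight; fun_prop

theorem integrableOn_betaWeight {α : ℝ} (h0 : 0 < α) (h1 : α < 1) :
    IntegrableOn (betaWeight α) (Ioo 0 1) := by
  have := integrableOn_rpow_mul_one_sub_rpow h0 (sub_pos.2 h1)
  unfold betaWeight
  simpa [sub_right_comm] using this

theorem integral_betaWeight {α : ℝ} (h0 : 0 < α) (h1 : α < 1) :
    ∫ t in Ioo (0 : ℝ) 1, betaWeight α t = betaMass α := by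
  have := integral_rpow_mul_one_sub_rpow h0 (sub_pos.2 h1)
  rw [Real.Gamma_mul_Gamma_one_sub] at this
  simpa [betaWeight, sub_right_comm, betaMass] using this

theorem pi_le_betaMass {α : ℝ} (h0 : 0 < α) (h1 : α < 1) : Real.pi ≤ betaMass α := by
  have hs : 0 < Real.sin (Real.pi * α) :=
    Real.sin_pos_of_pos_of_lt_pi (by positivity) (by nlinarith [Real.pi_pos])
  rw [betaMass, le_div_iff₀ hs]
  nlinarith [Real.sin_le_one (Real.pi * α), Real.pi_pos]

theorem betaMass_pos {α : ℝ} (h0 : 0 < α) (h1 : α < 1) : 0 < betaMass α :=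
  Real.pi_pos.trans_le (pi_le_betaMass h0 h1)

theorem integrableOn_betaWeight_mul_pow {α : ℝ} (h0 : 0 < α) (h1 : α < 1) (j : ℕ) :
    IntegrableOn (fun t => betaWeight α t * (1 - t) * t ^ j) (Ioo 0 1) := by
  have h := integrableOn_rpow_mul_one_sub_rpow (u := α + j) (v := 2 - α) (by positivity)
    (by linarith)
  refine h.congr_fun (fun t ht => ?_) measurableSet_Ioo
  have ht' : 0 < 1 - t := by linarith [ht.2]
  simp only [betaWeight]
  rw [show α + j - 1 = (α - 1) + j by ring, Real.rpow_add_natCast ht.1.ne',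
    show 2 - α - 1 = -α + 1 by ring, Real.rpow_add_one ht'.ne']
  ring

/-- The extra factor 1 - t gives an Euler integral with parameters α + j and 2 - α, whose sum j + 2
is an integer. Every such moment is therefore a polynomial in α times `betaMass α`. -/
theorem integral_betaWeight_mul_pow {α : ℝ} (h0 : 0 < α) (h1 : α < 1) (j : ℕ) :
    ∫ t in Ioo (0 : ℝ) 1, betaWeight α t * (1 - t) * t ^ j =
      Real.Gamma (α + j) * ((1 - α) * Real.Gamma (1 - α)) / ((j + 1) ! : ℕ) := by
  have h := integral_rpow_mul_one_sub_rpow (u := α + j) (v := 2 - α) (by positivity)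
    (by linarith)
  have e2 : Real.Gamma (2 - α) = (1 - α) * Real.Gamma (1 - α) := by
    rw [← Real.Gamma_add_one (by linarith)]; ring_nf
  have e3 : Real.Gamma (α + j + (2 - α)) = ((j + 1) ! : ℕ) := by
    rw [← Real.Gamma_nat_eq_factorial]; push_cast; ring_nf
  rw [e2, e3] at h
  rw [← h]
  refine setIntegral_congr_fun measurableSet_Ioo (fun t ht => ?_)
  have ht' : 0 < 1 - t := by linarith [ht.2]
  simp only [betaWeight]
  rw [show α + j - 1 = (α - 1) + j by ring, Real.rpow_add_natCast ht.1.ne',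
    show 2 - α - 1 = -α + 1 by ring, Real.rpow_add_one ht'.ne']
  ring

/-- The integral of a cubic polynomial against `betaWeight α t * (1 - t)`. -/
theorem integral_betaWeight_mul_cubic {α : ℝ} (h0 : 0 < α) (h1 : α < 1) (c₀ c₁ c₂ c₃ : ℝ) :
    ∫ t in Ioo (0 : ℝ) 1, betaWeight α t * (1 - t) * (c₀ + c₁ * t + c₂ * t ^ 2 + c₃ * t ^ 3) =
      (1 - α) * (c₀ + c₁ * (α / 2) + c₂ * (α * (α + 1) / 6) +
        c₃ * (α * (α + 1) * (α + 2) / 24)) * betaMass α := by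
  have i := integrableOn_betaWeight_mul_pow h0 h1
  have e : ∀ t, betaWeight α t * (1 - t) * (c₀ + c₁ * t + c₂ * t ^ 2 + c₃ * t ^ 3) =
      c₀ * (betaWeight α t * (1 - t) * t ^ 0) + c₁ * (betaWeight α t * (1 - t) * t ^ 1) +
      c₂ * (betaWeight α t * (1 - t) * t ^ 2) + c₃ * (betaWeight α t * (1 - t) * t ^ 3) :=
    fun t => by ring
  simp_rw [e]
  have i1 : IntegrableOn (fun t => c₀ * (betaWeight α t * (1 - t) * t ^ 0) +
      c₁ * (betaWeight α t * (1 - t) * t ^ 1)) (Ioo 0 1) :=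
    ((i 0).const_mul c₀).add ((i 1).const_mul c₁)
  have i2 : IntegrableOn (fun t => c₀ * (betaWeight α t * (1 - t) * t ^ 0) +
      c₁ * (betaWeight α t * (1 - t) * t ^ 1) + c₂ * (betaWeight α t * (1 - t) * t ^ 2))
      (Ioo 0 1) := i1.add ((i 2).const_mul c₂)
  rw [integral_add i2 ((i 3).const_mul c₃), integral_add i1 ((i 2).const_mul c₂),
    integral_add ((i 0).const_mul c₀) ((i 1).const_mul c₁)]
  simp only [integral_const_mul, integral_betaWeight_mul_pow h0 h1]
  have g1 : Real.Gamma (α + 1) = α * Real.Gamma α := Real.Gamma_add_one h0.ne'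
  have g2 : Real.Gamma (α + 2) = (α + 1) * (α * Real.Gamma α) := by
    rw [← g1, ← Real.Gamma_add_one (by positivity)]; ring_nf
  have g3 : Real.Gamma (α + 3) = (α + 2) * ((α + 1) * (α * Real.Gamma α)) := by
    rw [← g2, ← Real.Gamma_add_one (by positivity)]; ring_nf
  have gb : betaMass α = Real.Gamma α * Real.Gamma (1 - α) := by
    rw [Real.Gamma_mul_Gamma_one_sub, betaMass]
  push_cast
  rw [add_zero, g1, g2, g3, gb]
  norm_num [Nat.factorial]
  ring

theorem integrableOn_betaWeight_mul_cubic {α : ℝ} (h0 : 0 < α) (h1 : α < 1) (c₀ c₁ c₂ c₃ : ℝ) :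
    IntegrableOn (fun t => betaWeight α t * (1 - t) * (c₀ + c₁ * t + c₂ * t ^ 2 + c₃ * t ^ 3))
      (Ioo 0 1) := by
  have i := integrableOn_betaWeight_mul_pow h0 h1
  have e : ∀ t, betaWeight α t * (1 - t) * (c₀ + c₁ * t + c₂ * t ^ 2 + c₃ * t ^ 3) =
      c₀ * (betaWeight α t * (1 - t) * t ^ 0) + c₁ * (betaWeight α t * (1 - t) * t ^ 1) +
      c₂ * (betaWeight α t * (1 - t) * t ^ 2) + c₃ * (betaWeight α t * (1 - t) * t ^ 3) :=
    fun t => by ring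
  simp_rw [e]
  exact (((i 0).const_mul c₀).add ((i 1).const_mul c₁)).add ((i 2).const_mul c₂) |>.add
    ((i 3).const_mul c₃)

/-! ### The cumulative weight -/

/-- The integral of `betaWeight α` over `(0, 2 r / (1 + r))`. -/
noncomputable def cumBeta (α r : ℝ) : ℝ := ∫ t in (0 : ℝ)..(2 * r / (1 + r)), betaWeight α t

theorem intervalIntegrable_betaWeight {α : ℝ} (h0 : 0 < α) (h1 : α < 1) :
    IntervalIntegrable (betaWeight α) volume 0 1 := by
  rw [intervalIntegrable_iff_integrableOn_Ioo_of_le zero_le_one]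
  exact integrableOn_betaWeight h0 h1

theorem two_mul_div_one_add_mem_Icc {r : ℝ} (hr : r ∈ Icc (0 : ℝ) 1) :
    2 * r / (1 + r) ∈ Icc (0 : ℝ) 1 := by
  have := hr.1
  refine ⟨by positivity, ?_⟩
  rw [div_le_one (by positivity)]; linarith [hr.2]

theorem two_mul_div_one_add_mem_Ioo {r : ℝ} (hr : r ∈ Ioo (0 : ℝ) 1) :
    2 * r / (1 + r) ∈ Ioo (0 : ℝ) 1 := by
  have := hr.1
  refine ⟨by positivity, ?_⟩
  rw [div_lt_one (by positivity)]; linarith [hr.2]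

theorem cumBeta_zero (α : ℝ) : cumBeta α 0 = 0 := by simp [cumBeta]

theorem cumBeta_one {α : ℝ} (h0 : 0 < α) (h1 : α < 1) : cumBeta α 1 = betaMass α := by
  rw [cumBeta, show (2 * 1 / (1 + 1) : ℝ) = 1 by norm_num,
    intervalIntegral.integral_of_le zero_le_one, integral_Ioc_eq_integral_Ioo,
    integral_betaWeight h0 h1]

theorem continuousOn_cumBeta {α : ℝ} (h0 : 0 < α) (h1 : α < 1) :
    ContinuousOn (cumBeta α) (Icc 0 1) := by
  have h := intervalIntegral.continuousOn_primitive_interval' (a := 0)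
    (intervalIntegrable_betaWeight h0 h1) (by simp)
  rw [uIcc_of_le zero_le_one] at h
  refine h.comp (f := fun r : ℝ => 2 * r / (1 + r)) ?_ fun r hr => two_mul_div_one_add_mem_Icc hr
  exact ContinuousOn.div (by fun_prop) (by fun_prop) fun r hr => by linarith [hr.1]

/-- The logarithm of the ratio of the derivatives of `cumBeta α r` and `2 ^ α r ^ e / e`. -/
noncomputable def logRatio (α e r : ℝ) : ℝ :=
  (α - e) * Real.log r - α * Real.log (1 - r) - Real.log (1 + r)

/-- The left side is the chain-rule derivative of `cumBeta`. Splitting off r^(e-1), which also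
occurs in the derivative of B r^e, leaves a comparison of `logRatio` with a constant. -/
theorem betaWeight_comp_mul_deriv {α : ℝ} (e : ℝ) {r : ℝ} (hr : r ∈ Ioo (0 : ℝ) 1) :
    betaWeight α (2 * r / (1 + r)) * (2 / (1 + r) ^ 2) =
      r ^ (e - 1) * (2 ^ α * Real.exp (logRatio α e r)) := by
  have h0 := hr.1
  have h1 : 0 < 1 - r := by linarith [hr.2]
  have h2 : 0 < 1 + r := by linarith
  have e1 : 1 - 2 * r / (1 + r) = (1 - r) / (1 + r) := by field_simp; ring
  rw [betaWeight, e1]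
  have hw : 2 / (1 + r) ^ 2 = Real.exp (Real.log 2 - 2 * Real.log (1 + r)) := by
    rw [Real.exp_sub, Real.exp_log two_pos, two_mul, Real.exp_add, Real.exp_log h2, sq]
  rw [hw, Real.rpow_def_of_pos (by positivity), Real.rpow_def_of_pos (by positivity),
    Real.rpow_def_of_pos h0, Real.rpow_def_of_pos two_pos, Real.log_div (by positivity) h2.ne',
    Real.log_div h1.ne' h2.ne', Real.log_mul two_ne_zero h0.ne', ← Real.exp_add, ← Real.exp_add,
    ← Real.exp_add, ← Real.exp_add, logRatio]
  congr 1
  ring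

theorem hasDerivAt_cumBeta {α : ℝ} (h0 : 0 < α) (h1 : α < 1) (e : ℝ) {r : ℝ}
    (hr : r ∈ Ioo (0 : ℝ) 1) :
    HasDerivAt (cumBeta α) (r ^ (e - 1) * (2 ^ α * Real.exp (logRatio α e r))) r := by
  have hT := two_mul_div_one_add_mem_Ioo hr
  have hc : ContinuousAt (betaWeight α) (2 * r / (1 + r)) := by
    unfold betaWeight
    exact (Real.continuousAt_rpow_const _ _ (Or.inl hT.1.ne')).mul
      ((by fun_prop : ContinuousAt (fun t : ℝ => 1 - t) _).rpow_const
        (Or.inl (by linarith [hT.2])))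
  have h := intervalIntegral.integral_hasDerivAt_right (a := 0)
    ((intervalIntegrable_betaWeight h0 h1).mono_set (by
      rw [uIcc_of_le zero_le_one, uIcc_of_le hT.1.le]; exact Icc_subset_Icc_right hT.2.le))
    (measurable_betaWeight α).stronglyMeasurable.stronglyMeasurableAtFilter hc
  have hd : HasDerivAt (fun r : ℝ => 2 * r / (1 + r)) (2 / (1 + r) ^ 2) r := by
    have := ((hasDerivAt_id r).const_mul 2).div ((hasDerivAt_id r).const_add 1)
      (by simp; linarith [hr.1])
    convert! this using 1
    simp; ring
  rw [← betaWeight_comp_mul_deriv e hr]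
  exact HasDerivAt.comp r h hd

/-- For α ≤ e every logarithm enters `logRatio` with a nonpositive coefficient, so the function is
convex and its sublevel sets are intervals. -/
theorem logRatio_le_max {α e : ℝ} (h0 : 0 < α) (he : α ≤ e) {c x y z : ℝ}
    (hx : x ∈ Ioo (0 : ℝ) 1) (hz : z ∈ Ioo (0 : ℝ) 1) (hxy : x ≤ y) (hyz : y ≤ z)
    (hcx : logRatio α e x ≤ c) (hcz : logRatio α e z ≤ c) : logRatio α e y ≤ c := by
  have hcv : ConvexOn ℝ (Ioo (0 : ℝ) 1) (logRatio α e) := by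
    refine ⟨convex_Ioo _ _, fun x hx y hy a b ha hb hab => ?_⟩
    have l := strictConcaveOn_log_Ioi.concaveOn
    have l1 := l.2 (x := x) (y := y) hx.1 hy.1 ha hb hab
    have l2 := l.2 (x := 1 - x) (y := 1 - y) (sub_pos.2 hx.2) (sub_pos.2 hy.2) ha hb hab
    have l3 := l.2 (x := 1 + x) (y := 1 + y) (mem_Ioi.2 (by linarith [hx.1]))
      (mem_Ioi.2 (by linarith [hy.1])) ha hb hab
    simp only [smul_eq_mul, logRatio] at *
    rw [show a * (1 - x) + b * (1 - y) = 1 - (a * x + b * y) by linear_combination hab] at l2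
    rw [show a * (1 + x) + b * (1 + y) = 1 + (a * x + b * y) by linear_combination hab] at l3
    nlinarith [mul_le_mul_of_nonneg_left l1 (sub_nonneg.2 he), mul_le_mul_of_nonneg_left l2 h0.le]
  have := hcv.le_max_of_mem_Icc hx hz ⟨hxy, hyz⟩
  exact this.trans (max_le hcx hcz)

theorem hasDerivAt_sub_cumBeta {α : ℝ} (h0 : 0 < α) (h1 : α < 1) (B e : ℝ) {r : ℝ}
    (hr : r ∈ Ioo (0 : ℝ) 1) :
    HasDerivAt (fun r => B * r ^ e - cumBeta α r)
      (r ^ (e - 1) * (B * e - 2 ^ α * Real.exp (logRatio α e r))) r := by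
  have := ((Real.hasDerivAt_rpow_const (p := e) (Or.inl hr.1.ne')).const_mul B).sub
    (hasDerivAt_cumBeta h0 h1 e hr)
  convert! this using 1
  ring

theorem continuousOn_sub_cumBeta {α : ℝ} (h0 : 0 < α) (h1 : α < 1) (B : ℝ) {e : ℝ} (he : 0 ≤ e) :
    ContinuousOn (fun r => B * r ^ e - cumBeta α r) (Icc 0 1) :=
  (continuousOn_const.mul (Real.continuous_rpow_const he).continuousOn).sub
    (continuousOn_cumBeta h0 h1)

/-- The mean value theorem for `betaMass α * r ^ e - cumBeta α r`. -/
theorem exists_sub_cumBeta_slope {α e : ℝ} (h0 : 0 < α) (h1 : α < 1) (he : 0 ≤ e) {x y : ℝ}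
    (hx : 0 ≤ x) (hxy : x < y) (hy : y ≤ 1) :
    ∃ c ∈ Ioo x y, (betaMass α * y ^ e - cumBeta α y) - (betaMass α * x ^ e - cumBeta α x) =
      c ^ (e - 1) * (betaMass α * e - 2 ^ α * Real.exp (logRatio α e c)) * (y - x) := by
  obtain ⟨c, hc, h⟩ := exists_hasDerivAt_eq_slope (fun r => betaMass α * r ^ e - cumBeta α r)
    _ hxy ((continuousOn_sub_cumBeta h0 h1 _ he).mono (Icc_subset_Icc hx hy))
    fun c hc => hasDerivAt_sub_cumBeta h0 h1 _ e ⟨hx.trans_lt hc.1, hc.2.trans_le hy⟩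
  refine ⟨c, hc, ?_⟩
  rw [h, div_mul_cancel₀ _ (by linarith)]

/-- The difference D(r) = B r^e - `cumBeta α r` vanishes at 0 and 1, and D' ≥ 0 exactly on a
sublevel set of `logRatio`, an interval. If D were nonnegative at r and negative at a later s, it
would rise, fall and rise again, which an interval forbids. -/
theorem cumBeta_le_of_le {α e : ℝ} (h0 : 0 < α) (h1 : α < 1) (he : α ≤ e) {r s : ℝ}
    (hr : 0 < r) (hrs : r ≤ s) (hs : s ≤ 1) (h : cumBeta α r ≤ betaMass α * r ^ e) :
    cumBeta α s ≤ betaMass α * s ^ e := by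
  by_contra! hlt
  have he' : 0 < e := h0.trans_le he
  have hs1 : s ≠ 1 := by
    rintro rfl
    simp [cumBeta_one h0 h1] at hlt
  have hrs' : r ≠ s := by
    rintro rfl
    exact hlt.not_ge h
  -- Mean value points in (0,r), (r,s) and (s,1): the slopes there are ≥ 0, < 0 and > 0.
  obtain ⟨x, hx, ex⟩ := exists_sub_cumBeta_slope h0 h1 he'.le le_rfl hr (hrs.trans hs)
  obtain ⟨y, hy, ey⟩ := exists_sub_cumBeta_slope h0 h1 he'.le hr.le (hrs.lt_of_ne hrs') hs
  obtain ⟨z, hz, ez⟩ := exists_sub_cumBeta_slope h0 h1 he'.le (hr.le.trans hrs)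
    (hs.lt_of_ne hs1) le_rfl
  rw [cumBeta_zero, Real.zero_rpow he'.ne'] at ex
  rw [cumBeta_one h0 h1, Real.one_rpow] at ez
  have px := Real.rpow_pos_of_pos hx.1 (e - 1)
  have py := Real.rpow_pos_of_pos (hr.trans hy.1) (e - 1)
  have pz := Real.rpow_pos_of_pos (hr.trans_le hrs |>.trans hz.1) (e - 1)
  have hB := betaMass_pos h0 h1
  have h2 : (0 : ℝ) < 2 ^ α := by positivity
  -- The level of `logRatio` at which the derivative of the difference changes sign.
  set c := Real.log (betaMass α * e / 2 ^ α) with hcdef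
  have key : ∀ t, logRatio α e t ≤ c ↔ 0 ≤ betaMass α * e - 2 ^ α * Real.exp (logRatio α e t) := by
    intro t
    rw [hcdef, Real.le_log_iff_exp_le (by positivity), le_div_iff₀ h2, sub_nonneg, mul_comm]
  have kx : logRatio α e x ≤ c := by
    rw [key]
    by_contra! hneg
    have := mul_neg_of_neg_of_pos (mul_neg_of_pos_of_neg px hneg) (sub_pos.2 hr)
    linarith
  have kz : logRatio α e z ≤ c := by
    rw [key]
    by_contra! hneg
    have := mul_neg_of_neg_of_pos (mul_neg_of_pos_of_neg pz hneg) (sub_pos.2 (hs.lt_of_ne hs1))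
    linarith
  have ky := logRatio_le_max h0 he (y := y) ⟨hx.1, hx.2.trans_le (hrs.trans hs)⟩
    ⟨(hr.trans_le hrs).trans hz.1, hz.2⟩ (hx.2.trans hy.1).le (hy.2.trans hz.1).le kx kz
  rw [key] at ky
  have := mul_nonneg (mul_nonneg py.le ky) (sub_nonneg.2 hrs)
  linarith

/-- Near r = 1 the slope of `cumBeta` grows like (1-r)^(-α) while that of B r^e stays bounded. Both
functions equal B at 1, so B r^e lies above just before 1. -/
theorem exists_cumBeta_le {α e : ℝ} (h0 : 0 < α) (h1 : α < 1) (he : α ≤ e) :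
    ∃ r ∈ Ioo (0 : ℝ) 1, cumBeta α r ≤ betaMass α * r ^ e := by
  by_contra! hlt
  have he' : 0 < e := h0.trans_le he
  have hB := betaMass_pos h0 h1
  set Y := 2 * (betaMass α * e) with hY
  have hYpos : 0 < Y := by positivity
  -- Chosen so that (1-z)^(-α) / 2 ≥ (Y+1)/2 > B e throughout (1-δ, 1).
  set δ := (Y + 1) ^ (-(1 / α)) with hδ
  have hδ0 : 0 < δ := by positivity
  have hδ1 : δ < 1 := Real.rpow_lt_one_of_one_lt_of_neg (by linarith) (by
    have : 0 < 1 / α := by positivity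
    linarith)
  have hδα : δ ^ (-α) = Y + 1 := by
    rw [hδ, ← Real.rpow_mul (by positivity), show -(1 / α) * -α = 1 by field_simp, Real.rpow_one]
  obtain ⟨z, hz, ez⟩ := exists_sub_cumBeta_slope h0 h1 he'.le (x := 1 - δ) (y := 1) (by linarith)
    (by linarith) le_rfl
  rw [cumBeta_one h0 h1, Real.one_rpow] at ez
  have hz0 : 0 < z := by linarith [hz.1]
  have pz := Real.rpow_pos_of_pos hz0 (e - 1)
  have hW := hlt (1 - δ) ⟨by linarith, by linarith⟩
  have hpos : 0 < betaMass α * e - 2 ^ α * Real.exp (logRatio α e z) := by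
    by_contra! hneg
    have := mul_nonpos_of_nonpos_of_nonneg (mul_nonpos_of_nonneg_of_nonpos pz.le hneg)
      (sub_nonneg.2 (by linarith : 1 - δ ≤ 1))
    linarith
  have hexp : (1 - z) ^ (-α) / 2 ≤ Real.exp (logRatio α e z) := by
    have h1z : 0 < 1 - z := by linarith [hz.2]
    rw [Real.rpow_def_of_pos h1z, ← Real.exp_log (two_pos (α := ℝ)), ← Real.exp_sub,
      Real.exp_le_exp, logRatio]
    have l1 : Real.log (1 + z) ≤ Real.log 2 := Real.log_le_log (by linarith) (by linarith [hz.2])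
    have l2 : Real.log z ≤ 0 := Real.log_nonpos hz0.le hz.2.le
    nlinarith [mul_nonneg (sub_nonneg.2 he) (neg_nonneg.2 l2), Real.exp_log (two_pos (α := ℝ))]
  have h3 : Y + 1 ≤ (1 - z) ^ (-α) := by
    rw [← hδα]
    exact Real.rpow_le_rpow_of_nonpos (by linarith [hz.2]) (by linarith [hz.1]) (by linarith)
  have h4 : (1 : ℝ) ≤ 2 ^ α := Real.one_le_rpow (by norm_num) h0.le
  nlinarith [Real.exp_pos (logRatio α e z)]

/-- Replacing (1-t)^(-α) by 50/49 gives (50/49) (2r)^α / α. Since 2^α ≤ 1+α ≤ 3α for α ≥ 1/2, the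
constant is at most 150/49 < 3.14 < π ≤ B. -/
theorem cumBeta_le_mul_rpow_near_zero {α : ℝ} (hα : 1 / 2 ≤ α) (h1 : α < 1) {r : ℝ} (hr : 0 < r)
    (hr' : r ≤ 1 / 100) : cumBeta α r ≤ betaMass α * r ^ α := by
  have h0 : 0 < α := by linarith
  set T := 2 * r / (1 + r) with hT
  have hT0 : 0 < T := by positivity
  have hT1 : T ≤ 2 * r := by
    rw [hT, div_le_iff₀ (by positivity)]; nlinarith
  have hT2 : T ≤ 1 / 50 := by linarith
  have hint : IntervalIntegrable (fun t : ℝ => (50 / 49) * t ^ (α - 1)) volume 0 T :=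
    (intervalIntegral.intervalIntegrable_rpow' (by linarith)).const_mul _
  have hle : cumBeta α r ≤ ∫ t in (0 : ℝ)..T, (50 / 49) * t ^ (α - 1) := by
    refine intervalIntegral.integral_mono_on_of_le_Ioo hT0.le
      ((intervalIntegrable_betaWeight h0 h1).mono_set ?_) hint fun t ht => ?_
    · rw [uIcc_of_le zero_le_one, uIcc_of_le hT0.le]; exact Icc_subset_Icc_right (by linarith)
    · have ht1 : 49 / 50 ≤ 1 - t := by linarith [ht.2]
      have : (1 - t) ^ (-α) ≤ 50 / 49 := by
        calc (1 - t) ^ (-α) ≤ (49 / 50 : ℝ) ^ (-α) :=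
              Real.rpow_le_rpow_of_nonpos (by norm_num) ht1 (by linarith)
          _ ≤ (49 / 50 : ℝ) ^ (-1 : ℝ) :=
              Real.rpow_le_rpow_of_exponent_ge (by norm_num) (by norm_num) (by linarith)
          _ = 50 / 49 := by rw [Real.rpow_neg_one]; norm_num
      rw [betaWeight, mul_comm]
      exact mul_le_mul_of_nonneg_right this (Real.rpow_nonneg ht.1.le _)
  rw [intervalIntegral.integral_const_mul, integral_rpow (Or.inl (by linarith)), sub_add_cancel,
    Real.zero_rpow h0.ne', sub_zero] at hle
  have h2 : T ^ α ≤ (1 + α) * r ^ α := by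
    calc T ^ α ≤ (2 * r) ^ α := Real.rpow_le_rpow hT0.le hT1 h0.le
      _ = 2 ^ α * r ^ α := Real.mul_rpow (by norm_num) hr.le
      _ ≤ (1 + α) * r ^ α := by
        refine mul_le_mul_of_nonneg_right ?_ (Real.rpow_nonneg hr.le _)
        have := rpow_one_add_le_one_add_mul_self (s := 1) (by norm_num) h0.le h1.le
        norm_num at this ⊢
        linarith
  have h3 : T ^ α / α ≤ 3 * r ^ α := by
    rw [div_le_iff₀ h0]
    nlinarith [Real.rpow_nonneg hr.le α]
  have := pi_le_betaMass h0 h1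
  nlinarith [Real.rpow_nonneg hr.le α, Real.pi_gt_d2]

/-- For `1 / 2 ≤ α < 1` the cumulative weight satisfies `cumBeta α r ≤ betaMass α * r ^ α`. -/
theorem cumBeta_le_mul_rpow {α : ℝ} (hα : 1 / 2 ≤ α) (h1 : α < 1) {r : ℝ} (hr : 0 < r)
    (hr' : r ≤ 1) : cumBeta α r ≤ betaMass α * r ^ α :=
  cumBeta_le_of_le (by linarith) h1 le_rfl (r := min r (1 / 100)) (by positivity)
    (min_le_left _ _) hr' (cumBeta_le_mul_rpow_near_zero hα h1 (by positivity) (min_le_right _ _))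

/-! ### The weighted radial inequality -/

/-- Bernoulli for the exponent 1-a gives x ≤ x^a (1-u) with u = (1-a)(1-x). Multiplying by 1+u
yields x (1+u) ≤ x^a (1-u²) ≤ x^a, which is the claim. -/
theorem one_sub_rpow_le_of_le_one {a x : ℝ} (ha0 : 0 < a) (ha1 : a ≤ 1) (hx : 0 ≤ x)
    (hx1 : x ≤ 1) : 1 - x ^ a ≤ (1 - x) * (1 - (1 - a) * x) := by
  rcases hx.eq_or_lt with rfl | hx0
  · simp [Real.zero_rpow ha0.ne']
  have h1 := rpow_one_add_le_one_add_mul_self (s := x - 1) (by linarith) (sub_nonneg.2 ha1)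
    (by linarith : 1 - a ≤ 1)
  rw [add_sub_cancel] at h1
  have h2 : x = x ^ a * x ^ (1 - a) := by
    rw [← Real.rpow_add hx0, add_sub_cancel, Real.rpow_one]
  set u := (1 - a) * (1 - x) with hu
  have hu0 : 0 ≤ u := mul_nonneg (by linarith) (by linarith)
  have h3 : x ≤ x ^ a * (1 - u) := by
    calc x = x ^ a * x ^ (1 - a) := h2
      _ ≤ x ^ a * (1 - u) := by gcongr; linarith
  have h4 : x * (1 + u) ≤ x ^ a := by
    have := mul_le_mul_of_nonneg_right h3 (by linarith : 0 ≤ 1 + u)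
    nlinarith [mul_nonneg (Real.rpow_nonneg hx a) (sq_nonneg u)]
  nlinarith

/-- This is a ∫ s^(a-1) ds over (x,1), with the concave s^(a-1) replaced by its tangent line at s =
1. -/
theorem one_sub_rpow_le_of_one_le {a x : ℝ} (ha1 : 1 ≤ a) (ha2 : a ≤ 2) (hx : 0 ≤ x)
    (hx1 : x ≤ 1) : 1 - x ^ a ≤ a * ((1 - x) * ((2 - a) + (a - 1) * (1 + x) / 2)) := by
  have hd : ∀ y : ℝ, HasDerivAt
      (fun y => a * ((1 - y) * ((2 - a) + (a - 1) * (1 + y) / 2)) + y ^ a)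
      (a * (y ^ (a - 1) - (2 - a) - (a - 1) * y)) y := by
    intro y
    have h1 : HasDerivAt (fun y : ℝ => 1 - y) (-1) y := by
      simpa using (hasDerivAt_id y).const_sub 1
    have h2 : HasDerivAt (fun y : ℝ => (2 - a) + (a - 1) * (1 + y) / 2) ((a - 1) * 1 / 2) y :=
      ((((hasDerivAt_id y).const_add 1).const_mul (a - 1)).div_const 2).const_add (2 - a)
    convert! ((h1.mul h2).const_mul a).add (Real.hasDerivAt_rpow_const (p := a) (Or.inr ha1))
      using 1
    ring
  have hanti : AntitoneOn
      (fun y => a * ((1 - y) * ((2 - a) + (a - 1) * (1 + y) / 2)) + y ^ a) (Icc 0 1) := by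
    refine antitoneOn_of_deriv_nonpos (convex_Icc 0 1)
      (fun y _ => (hd y).continuousAt.continuousWithinAt)
      (fun y _ => (hd y).differentiableAt.differentiableWithinAt) fun y hy => ?_
    rw [interior_Icc] at hy
    rw [(hd y).deriv]
    have := rpow_one_add_le_one_add_mul_self (s := y - 1) (by linarith [hy.1])
      (sub_nonneg.2 ha1) (by linarith : a - 1 ≤ 1)
    rw [add_sub_cancel] at this
    exact mul_nonpos_of_nonneg_of_nonpos (by linarith) (by linarith)
  have := hanti ⟨hx, hx1⟩ ⟨zero_le_one, le_rfl⟩ hx1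
  simp only [sub_self, zero_mul, mul_zero, Real.one_rpow] at this
  linarith

theorem div_two_sub_lt_iff {r t : ℝ} (hr : 0 < r) (ht : t < 1) :
    t / (2 - t) < r ↔ t < 2 * r / (1 + r) := by
  rw [div_lt_iff₀ (by linarith), lt_div_iff₀ (by linarith)]
  constructor <;> intro h <;> linarith

theorem ofReal_cumBeta {α : ℝ} (h0 : 0 < α) (h1 : α < 1) {r : ℝ} (hr : r ∈ Ioo (0 : ℝ) 1) :
    ENNReal.ofReal (cumBeta α r) = ∫⁻ t in Ioo (0 : ℝ) 1,
      (Ioi (t / (2 - t))).indicator (fun _ => ENNReal.ofReal (betaWeight α t)) r := by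
  have hT := two_mul_div_one_add_mem_Ioo hr
  have hsub : Ioo 0 (2 * r / (1 + r)) ⊆ Ioo (0 : ℝ) 1 := Ioo_subset_Ioo_right hT.2.le
  rw [cumBeta, intervalIntegral.integral_of_le hT.1.le, integral_Ioc_eq_integral_Ioo,
    ofReal_integral_eq_lintegral_ofReal ((integrableOn_betaWeight h0 h1).mono_set hsub)
      ((ae_restrict_iff' measurableSet_Ioo).2 (.of_forall fun t ht =>
        (betaWeight_pos ht.1 (hsub ht).2).le))]
  rw [← inter_eq_right.2 hsub, ← Measure.restrict_restrict measurableSet_Ioo,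
    Measure.restrict_restrict measurableSet_Ioo, inter_comm,
    ← setLIntegral_indicator measurableSet_Ioo]
  refine setLIntegral_congr_fun measurableSet_Ioo fun t ht => ?_
  simp only [indicator_apply, mem_Ioi, mem_Ioo, div_two_sub_lt_iff hr.1 ht.2, ht.1, true_and]

theorem lintegral_rpow_Ioo {a x : ℝ} (ha : 0 < a) (hx : x ∈ Ico (0 : ℝ) 1) :
    ∫⁻ r in Ioo x 1, ENNReal.ofReal (r ^ (a - 1)) = ENNReal.ofReal ((1 - x ^ a) / a) := by
  have hi : IntervalIntegrable (fun r : ℝ => r ^ (a - 1)) volume x 1 :=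
    intervalIntegral.intervalIntegrable_rpow' (by linarith)
  rw [intervalIntegrable_iff_integrableOn_Ioo_of_le hx.2.le] at hi
  rw [← ofReal_integral_eq_lintegral_ofReal hi ((ae_restrict_iff' measurableSet_Ioo).2
      (.of_forall fun t ht => Real.rpow_nonneg (hx.1.trans ht.1.le) _)),
    ← integral_Ioc_eq_integral_Ioo, ← intervalIntegral.integral_of_le hx.2.le,
    integral_rpow (Or.inl (by linarith)), sub_add_cancel, Real.one_rpow]

/-- Tonelli on the region t/(2-t) < r < 1, integrating in r first. -/
theorem lintegral_rpow_mul_cumBeta {α a : ℝ} (h0 : 0 < α) (h1 : α < 1) (ha : 0 < a) :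
    ∫⁻ r in Ioo (0 : ℝ) 1, ENNReal.ofReal (r ^ (a - 1) * cumBeta α r) =
      ∫⁻ t in Ioo (0 : ℝ) 1, ENNReal.ofReal (betaWeight α t * ((1 - (t / (2 - t)) ^ a) / a)) := by
  have hm : Measurable fun q : ℝ × ℝ => ENNReal.ofReal (q.1 ^ (a - 1)) *
      {q : ℝ × ℝ | q.2 / (2 - q.2) < q.1}.indicator
        (fun q => ENNReal.ofReal (betaWeight α q.2)) q := by
    refine Measurable.mul (by fun_prop) (Measurable.indicator ?_ ?_)
    · exact ENNReal.measurable_ofReal.comp ((measurable_betaWeight α).comp measurable_snd)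
    · exact measurableSet_lt (by fun_prop) (by fun_prop)
  calc _ = ∫⁻ r in Ioo (0 : ℝ) 1, ∫⁻ t in Ioo (0 : ℝ) 1, ENNReal.ofReal (r ^ (a - 1)) *
          {q : ℝ × ℝ | q.2 / (2 - q.2) < q.1}.indicator
            (fun q => ENNReal.ofReal (betaWeight α q.2)) (r, t) := by
        refine setLIntegral_congr_fun measurableSet_Ioo fun r hr => ?_
        rw [ENNReal.ofReal_mul (Real.rpow_nonneg hr.1.le _), ofReal_cumBeta h0 h1 hr,
          ← lintegral_const_mul']
        · rfl
        · exact ENNReal.ofReal_ne_top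
    _ = ∫⁻ t in Ioo (0 : ℝ) 1, ∫⁻ r in Ioo (0 : ℝ) 1, ENNReal.ofReal (r ^ (a - 1)) *
          {q : ℝ × ℝ | q.2 / (2 - q.2) < q.1}.indicator
            (fun q => ENNReal.ofReal (betaWeight α q.2)) (r, t) :=
        lintegral_lintegral_swap hm.aemeasurable
    _ = _ := by
        refine setLIntegral_congr_fun measurableSet_Ioo fun t ht => ?_
        have hρ : t / (2 - t) ∈ Ioo (0 : ℝ) 1 :=
          ⟨div_pos ht.1 (by linarith [ht.2]), by
            rw [div_lt_one (by linarith [ht.2])]; linarith [ht.2]⟩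
        have e : ∀ r, ENNReal.ofReal (r ^ (a - 1)) *
            {q : ℝ × ℝ | q.2 / (2 - q.2) < q.1}.indicator
              (fun q => ENNReal.ofReal (betaWeight α q.2)) (r, t) =
            ENNReal.ofReal (betaWeight α t) *
              (Ioi (t / (2 - t))).indicator (fun r => ENNReal.ofReal (r ^ (a - 1))) r := by
          intro r
          by_cases h : t / (2 - t) < r <;> simp [h, mul_comm]
        simp only [e]
        rw [lintegral_const_mul' _ _ ENNReal.ofReal_ne_top,
          setLIntegral_indicator measurableSet_Ioi,
          show Ioi (t / (2 - t)) ∩ Ioo 0 1 = Ioo (t / (2 - t)) 1 by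
            ext r; simp only [mem_inter_iff, mem_Ioi, mem_Ioo]
            exact ⟨fun h => ⟨h.1, h.2.2⟩, fun h => ⟨h.1, hρ.1.trans h.1, h.2⟩⟩,
          lintegral_rpow_Ioo ha (Ioo_subset_Ico_self hρ), ENNReal.ofReal_mul (betaWeight_pos ht.1 ht.2).le]

/-- The quadratic touches 1/(2-t) to first order at 0 and agrees with it at 1: (2-t)(2+t+t²) = 4 +
t²(1-t). The next bound is built likewise. -/
theorem inv_two_sub_le {t : ℝ} (h1 : t ≤ 1) : 1 / (2 - t) ≤ (2 + t + t ^ 2) / 4 := by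
  rw [div_le_div_iff₀ (by linarith) (by norm_num)]
  nlinarith [mul_nonneg (sq_nonneg t) (sub_nonneg.2 h1)]

theorem inv_two_sub_sq_le {t : ℝ} (h1 : t ≤ 1) :
    1 / (2 - t) ^ 2 ≤ (1 + t + 2 * t ^ 2) / 4 := by
  rw [div_le_div_iff₀ (by nlinarith) (by norm_num)]
  nlinarith [mul_nonneg (mul_nonneg (sq_nonneg t) (sub_nonneg.2 h1)) (by linarith : 0 ≤ 5 - 2 * t)]

theorem lintegral_le_of_cubic_bound {α : ℝ} (h0 : 0 < α) (h1 : α < 1) {F : ℝ → ℝ}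
    {c₀ c₁ c₂ c₃ : ℝ}
    (hF0 : ∀ t ∈ Ioo (0 : ℝ) 1, 0 ≤ F t)
    (hF : ∀ t ∈ Ioo (0 : ℝ) 1, F t ≤ (1 - t) * (c₀ + c₁ * t + c₂ * t ^ 2 + c₃ * t ^ 3))
    (hc : (1 - α) * (c₀ + c₁ * (α / 2) + c₂ * (α * (α + 1) / 6) +
        c₃ * (α * (α + 1) * (α + 2) / 24)) ≤ 1 / 2) :
    ∫⁻ t in Ioo (0 : ℝ) 1, ENNReal.ofReal (betaWeight α t * F t) ≤
      ENNReal.ofReal (betaMass α / 2) := by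
  have hle : ∀ t ∈ Ioo (0 : ℝ) 1, betaWeight α t * F t ≤
      betaWeight α t * (1 - t) * (c₀ + c₁ * t + c₂ * t ^ 2 + c₃ * t ^ 3) := fun t ht => by
    rw [mul_assoc]
    exact mul_le_mul_of_nonneg_left (hF t ht) (betaWeight_pos ht.1 ht.2).le
  calc _ ≤ ∫⁻ t in Ioo (0 : ℝ) 1, ENNReal.ofReal
        (betaWeight α t * (1 - t) * (c₀ + c₁ * t + c₂ * t ^ 2 + c₃ * t ^ 3)) :=
        setLIntegral_mono' measurableSet_Ioo fun t ht => ENNReal.ofReal_le_ofReal (hle t ht)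
    _ = ENNReal.ofReal (∫ t in Ioo (0 : ℝ) 1,
        betaWeight α t * (1 - t) * (c₀ + c₁ * t + c₂ * t ^ 2 + c₃ * t ^ 3)) := by
        rw [ofReal_integral_eq_lintegral_ofReal (integrableOn_betaWeight_mul_cubic h0 h1 ..)]
        exact (ae_restrict_iff' measurableSet_Ioo).2 (.of_forall fun t ht =>
          (mul_nonneg (betaWeight_pos ht.1 ht.2).le (hF0 t ht)).trans (hle t ht))
    _ ≤ _ := by
        rw [integral_betaWeight_mul_cubic h0 h1]
        refine ENNReal.ofReal_le_ofReal ?_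
        have := mul_le_mul_of_nonneg_right hc (betaMass_pos h0 h1).le
        linarith

/-- After Tonelli the integrand is `betaWeight` times (1-ρ^a)/a, with ρ = t/(2-t) and a = p-2. A
majorant (1-t) · (cubic) turns the claim into a polynomial inequality in α, because aα = 2-2α
eliminates a. -/
theorem lintegral_rpow_mul_cumBeta_le {p : ℝ} (hp2 : 2 < p) (hp4 : p < 4) :
    ∫⁻ r in Ioo (0 : ℝ) 1, ENNReal.ofReal (r ^ (p - 3) * cumBeta (2 / p) r) ≤
      ENNReal.ofReal (betaMass (2 / p) / 2) := by
  set α := 2 / p with hα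
  have hp0 : 0 < p := by linarith
  have h0 : 0 < α := by positivity
  have h1 : α < 1 := by rw [hα, div_lt_one hp0]; exact hp2
  have hh : 1 / 2 ≤ α := by rw [hα, div_le_div_iff₀ two_pos hp0]; linarith
  set a := p - 2 with ha
  have ha0 : 0 < a := by linarith
  have hrel : a * α = 2 - 2 * α := by rw [ha, hα]; field_simp
  rw [show p - 3 = a - 1 by rw [ha]; ring, lintegral_rpow_mul_cumBeta h0 h1 ha0]
  have hρ : ∀ t ∈ Ioo (0 : ℝ) 1, t / (2 - t) ∈ Icc (0 : ℝ) 1 := fun t ht =>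
    ⟨div_nonneg ht.1.le (by linarith [ht.2]), by
      rw [div_le_one (by linarith [ht.2])]; linarith [ht.2]⟩
  have hF0 : ∀ t ∈ Ioo (0 : ℝ) 1, 0 ≤ (1 - (t / (2 - t)) ^ a) / a := fun t ht =>
    div_nonneg (sub_nonneg.2 (Real.rpow_le_one (hρ t ht).1 (hρ t ht).2 ha0.le)) ha0.le
  have e1 : ∀ t ∈ Ioo (0 : ℝ) 1, 1 - t / (2 - t) = 2 * (1 - t) * (1 / (2 - t)) := fun t ht => by
    have : 2 - t ≠ 0 := by linarith [ht.2]
    field_simp; ring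
  rcases le_total a 1 with hle | hle
  -- These coefficients are the expansion of (2-(2-a)t)(1+t+2t²)/(2a). The condition a ≤ 1
  -- corresponds to α ≥ 2/3, and the resulting quartic in α has its maximum near 4/5.
  · refine lintegral_le_of_cubic_bound h0 h1 (c₀ := 1 / a) (c₁ := 1 / 2)
      (c₂ := (2 + a) / (2 * a)) (c₃ := -(2 - a) / a) hF0 (fun t ht => ?_) ?_
    · have ht2 : 2 - t ≠ 0 := by linarith [ht.2]
      rw [div_le_iff₀ ha0]
      refine (one_sub_rpow_le_of_le_one ha0 hle (hρ t ht).1 (hρ t ht).2).trans ?_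
      have e2 : (1 - t / (2 - t)) * (1 - (1 - a) * (t / (2 - t))) =
          2 * (1 - t) * (2 - (2 - a) * t) * (1 / (2 - t) ^ 2) := by
        field_simp; ring
      have hpos : 0 ≤ 2 * (1 - t) * (2 - (2 - a) * t) :=
        mul_nonneg (by linarith [ht.2]) (by nlinarith [ht.1, ht.2])
      rw [e2]
      refine (mul_le_mul_of_nonneg_left (inv_two_sub_sq_le ht.2.le) hpos).trans
        (le_of_eq ?_)
      field_simp; ring
    · have haα : 1 / a = α / (2 * (1 - α)) := by
        rw [div_eq_div_iff ha0.ne' (by linarith)]; linarith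
      have h1' : 1 - α ≠ 0 := by linarith
      have e3 : (1 - α) * (1 / a + 1 / 2 * (α / 2) + (2 + a) / (2 * a) * (α * (α + 1) / 6) +
          -(2 - a) / a * (α * (α + 1) * (α + 2) / 24)) =
          (22 * α - 5 * α ^ 2 - 5 * α ^ 3 - 2 * α ^ 4) / 24 := by
        have haa : a = 2 * (1 - α) / α := by field_simp; linarith
        rw [haa]; field_simp; ring
      rw [e3]
      have ha23 : 2 / 3 ≤ α := by nlinarith
      nlinarith [mul_nonneg (sub_nonneg.2 ha23) (sub_nonneg.2 h1.le), sq_nonneg (α - 4 / 5),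
        mul_nonneg h0.le (sq_nonneg (α - 4 / 5)), sq_nonneg (α ^ 2 - 16 / 25)]
  -- Here a ≥ 1, hence 1/2 ≤ α ≤ 2/3, and a quadratic factor suffices.
  · refine lintegral_le_of_cubic_bound h0 h1 (c₀ := (3 - a) / 2) (c₁ := 1 / 2)
      (c₂ := a / 2) (c₃ := 0) hF0 (fun t ht => ?_) ?_
    · have ht2 : 0 < 2 - t := by linarith [ht.2]
      rw [div_le_iff₀ ha0]
      refine (one_sub_rpow_le_of_one_le hle (by linarith) (hρ t ht).1 (hρ t ht).2).trans ?_
      have e2 : (1 - t / (2 - t)) * (2 - a + (a - 1) * (1 + t / (2 - t)) / 2) =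
          2 * (1 - t) * ((2 - a) * (1 / (2 - t)) + (a - 1) * (1 / (2 - t) ^ 2)) := by
        field_simp; ring
      rw [e2, mul_comm a]
      refine mul_le_mul_of_nonneg_right ?_ ha0.le
      have b1 := mul_le_mul_of_nonneg_left (inv_two_sub_le ht.2.le)
        (by linarith : 0 ≤ 2 - a)
      have b2 := mul_le_mul_of_nonneg_left (inv_two_sub_sq_le ht.2.le)
        (by linarith : 0 ≤ a - 1)
      refine (mul_le_mul_of_nonneg_left (add_le_add b1 b2)
        (by linarith [ht.2] : 0 ≤ 2 * (1 - t))).trans (le_of_eq ?_)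
      ring
    · have ha23 : α ≤ 2 / 3 := by nlinarith
      have haa : a = 2 * (1 - α) / α := by field_simp; linarith
      have e3 : (1 - α) * ((3 - a) / 2 + 1 / 2 * (α / 2) + a / 2 * (α * (α + 1) / 6) +
          0 * (α * (α + 1) * (α + 2) / 24)) =
          (1 - α) * (-12 + 32 * α + 3 * α ^ 2 - 2 * α ^ 3) / (12 * α) := by
        rw [haa]; field_simp; ring
      rw [e3, div_le_iff₀ (by positivity)]
      nlinarith [mul_nonneg (sub_nonneg.2 hh) (sub_nonneg.2 ha23), sq_nonneg (α - 2 / 3),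
        mul_nonneg h0.le (mul_nonneg (sub_nonneg.2 hh) (sub_nonneg.2 ha23)),
        mul_nonneg (sq_nonneg α) (mul_nonneg (sub_nonneg.2 hh) (sub_nonneg.2 ha23))]

/-! ### Chebyshev comparison of the two radial kernels -/

theorem lintegral_ofReal_id_Ioo :
    ∫⁻ r in Ioo (0 : ℝ) 1, ENNReal.ofReal r = ENNReal.ofReal (1 / 2) := by
  have := lintegral_rpow_Ioo (a := 2) (x := 0) two_pos ⟨le_rfl, one_pos⟩
  norm_num at this ⊢
  exact this

/-- A Chebyshev-type inequality: increasing functions have more `r dr`-mass than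
`r ^ (p - 3) cumBeta r dr`-mass, up to the factor `betaMass`. -/
theorem lintegral_rpow_mul_cumBeta_mul_le {p : ℝ} (hp2 : 2 < p) (hp4 : p < 4) {M : ℝ → ℝ≥0∞}
    (hM : MonotoneOn M (Ioo 0 1)) (hfin : ∀ r ∈ Ioo (0 : ℝ) 1, M r ≠ ∞) :
    ∫⁻ r in Ioo (0 : ℝ) 1, ENNReal.ofReal (r ^ (p - 3) * cumBeta (2 / p) r) * M r ≤
      ENNReal.ofReal (betaMass (2 / p)) * ∫⁻ r in Ioo (0 : ℝ) 1, ENNReal.ofReal r * M r := by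
  have hmom := lintegral_rpow_mul_cumBeta_le hp2 hp4
  set α := 2 / p with hα
  have hp0 : 0 < p := by linarith
  have h0 : 0 < α := by positivity
  have h1 : α < 1 := by rw [hα, div_lt_one hp0]; exact hp2
  have hh : 1 / 2 ≤ α := by rw [hα, div_le_div_iff₀ two_pos hp0]; linarith
  have hB := betaMass_pos h0 h1
  have hMm : AEMeasurable M (volume.restrict (Ioo 0 1)) :=
    aemeasurable_restrict_of_monotoneOn measurableSet_Ioo hM
  have hmul : ∀ r ∈ Ioo (0 : ℝ) 1, ∀ c, c = betaMass α * r ^ (4 - p) →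
      r ^ (p - 3) * c = betaMass α * r := by
    rintro r hr _ rfl
    rw [mul_left_comm, ← Real.rpow_add hr.1, show p - 3 + (4 - p) = 1 by ring, Real.rpow_one]
  rw [← lintegral_const_mul' _ _ ENNReal.ofReal_ne_top]
  simp_rw [← mul_assoc, ← ENNReal.ofReal_mul hB.le]
  -- When 4-p ≤ α, B r^α ≤ B r^(4-p) and the kernels compare pointwise. Otherwise the crossing
  -- argument with exponent e = 4-p is available.
  rcases le_total (4 - p) α with hcase | hcase
  · refine setLIntegral_mono' measurableSet_Ioo fun r hr => ?_
    refine mul_le_mul' (ENNReal.ofReal_le_ofReal ?_) le_rfl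
    rw [← hmul r hr _ rfl]
    refine mul_le_mul_of_nonneg_left ?_ (Real.rpow_nonneg hr.1.le _)
    refine (cumBeta_le_mul_rpow hh h1 hr.1 hr.2.le).trans ?_
    exact mul_le_mul_of_nonneg_left (Real.rpow_le_rpow_of_exponent_ge hr.1 hr.2.le hcase) hB.le
  set U := {r | r ∈ Ioo (0 : ℝ) 1 ∧ cumBeta α r ≤ betaMass α * r ^ (4 - p)} with hU
  -- The value of M at the crossing: M ≥ M₀ on U, and M ≤ M₀ off U because U is closed to the right.
  set M₀ := ⨅ r ∈ U, M r with hM₀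
  obtain ⟨u, hu01, hu⟩ := exists_cumBeta_le h0 h1 hcase
  have hM₀fin : M₀ ≠ ∞ := ne_top_of_le_ne_top (hfin u hu01) (iInf₂_le u ⟨hu01, hu⟩)
  -- This says (B r - r^(p-3) G)(M - M₀) ≥ 0, written without subtraction in `ℝ≥0∞`.
  have hpt : ∀ r ∈ Ioo (0 : ℝ) 1,
      ENNReal.ofReal (r ^ (p - 3) * cumBeta α r) * M r + ENNReal.ofReal (betaMass α * r) * M₀ ≤
      ENNReal.ofReal (betaMass α * r) * M r + ENNReal.ofReal (r ^ (p - 3) * cumBeta α r) * M₀ := by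
    intro r hr
    have hrp := Real.rpow_nonneg hr.1.le (p - 3)
    have key : ∀ a b c d : ℝ≥0∞, a ≤ b → c ≤ d → a * d + b * c ≤ b * d + a * c := by
      intro a b c d hab hcd
      obtain ⟨x, rfl⟩ := le_iff_exists_add.1 hab
      obtain ⟨y, rfl⟩ := le_iff_exists_add.1 hcd
      calc a * (c + y) + (a + x) * c ≤ a * (c + y) + (a + x) * c + x * y := le_self_add
        _ = (a + x) * (c + y) + a * c := by ring
    by_cases hrU : r ∈ U
    · refine key _ _ _ _ (ENNReal.ofReal_le_ofReal ?_) (iInf₂_le r hrU)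
      rw [← hmul r hr _ rfl]
      exact mul_le_mul_of_nonneg_left hrU.2 hrp
    · have hlt : betaMass α * r ^ (4 - p) < cumBeta α r := by
        by_contra! h
        exact hrU ⟨hr, h⟩
      rw [add_comm, add_comm (_ * M r)]
      refine key _ _ _ _ (ENNReal.ofReal_le_ofReal ?_) (le_iInf₂ fun s hs => ?_)
      · rw [← hmul r hr _ rfl]
        exact mul_le_mul_of_nonneg_left hlt.le hrp
      · refine hM hr hs.1 (le_of_not_gt fun hsr => ?_)
        exact hrU ⟨hr, cumBeta_le_of_le h0 h1 hcase hs.1.1 hsr.le hr.2.le hs.2⟩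
  have hint := setLIntegral_mono' (μ := volume) measurableSet_Ioo hpt
  have hA : AEMeasurable (fun r => ENNReal.ofReal (betaMass α * r) * M r)
      (volume.restrict (Ioo 0 1)) := AEMeasurable.mul (by fun_prop) hMm
  rw [lintegral_add_right _ (by fun_prop), lintegral_add_left' hA,
    lintegral_mul_const' _ _ hM₀fin, lintegral_mul_const' _ _ hM₀fin] at hint
  simp_rw [ENNReal.ofReal_mul (p := betaMass α) hB.le] at hint
  have e5 : ∫⁻ r in Ioo (0 : ℝ) 1, ENNReal.ofReal (betaMass α) * ENNReal.ofReal r =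
      ENNReal.ofReal (betaMass α / 2) := by
    rw [lintegral_const_mul' _ _ ENNReal.ofReal_ne_top, lintegral_ofReal_id_Ioo,
      ← ENNReal.ofReal_mul hB.le, mul_one_div]
  rw [e5] at hint
  simp_rw [ENNReal.ofReal_mul (p := betaMass α) hB.le]
  refine (ENNReal.add_le_add_iff_right
    (ENNReal.mul_ne_top (ENNReal.ofReal_ne_top (r := betaMass α / 2)) hM₀fin)).1 ?_
  exact hint.trans (by gcongr)

/-! ### Integral means of analytic functions -/

theorem measurable_indicator_of_continuousOn {s : Set ℂ} (hs : MeasurableSet s) {β : Type*}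
    [TopologicalSpace β] [MeasurableSpace β] [BorelSpace β] [Zero β] {f : ℂ → β}
    (hf : ContinuousOn f s) : Measurable (s.indicator f) := by
  classical
  rw [← piecewise_eq_indicator]
  exact hf.measurable_piecewise continuousOn_const hs

theorem measurableSet_disc : MeasurableSet disc := measurableSet_ball

theorem circleMap_mem_disc {r : ℝ} (h0 : 0 ≤ r) (h1 : r < 1) (θ : ℝ) :
    circleMap 0 r θ ∈ disc := by
  simp [disc, abs_of_nonneg h0, h1]

/-- Integration in polar coordinates over the unit disc. -/
theorem setLIntegral_disc_eq_polar {Φ : ℂ → ℝ≥0∞} (hΦ : Measurable Φ) :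
    ∫⁻ z in disc, Φ z = ∫⁻ r in Ioo (0 : ℝ) 1,
      ENNReal.ofReal r * ∫⁻ θ in Ioo (-Real.pi) Real.pi, Φ (circleMap 0 r θ) := by
  have hs : ∀ q : ℝ × ℝ, Complex.polarCoord.symm q = circleMap 0 q.1 q.2 := fun q => by
    rw [Complex.polarCoord_symm_apply, circleMap_zero, Complex.exp_mul_I, Complex.ofReal_cos,
      Complex.ofReal_sin]
  have hm : Measurable (fun q : ℝ × ℝ => ENNReal.ofReal q.1 *
      (disc.indicator Φ) (circleMap 0 q.1 q.2)) := by
    refine Measurable.mul (by fun_prop) ((hΦ.indicator measurableSet_disc).comp ?_)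
    unfold circleMap
    fun_prop
  rw [← lintegral_indicator measurableSet_disc, ← Complex.lintegral_comp_polarCoord_symm]
  simp only [hs, smul_eq_mul]
  rw [polarCoord_target, Measure.volume_eq_prod,
    setLIntegral_prod _ (hm.aemeasurable)]
  rw [← lintegral_indicator measurableSet_Ioi, ← lintegral_indicator measurableSet_Ioo]
  refine lintegral_congr fun r => ?_
  by_cases h0 : 0 < r
  · rw [indicator_of_mem (mem_Ioi.2 h0), lintegral_const_mul' _ _ ENNReal.ofReal_ne_top]
    by_cases h1 : r < 1
    · rw [indicator_of_mem (show r ∈ Ioo (0 : ℝ) 1 from ⟨h0, h1⟩)]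
      simp_rw [indicator_of_mem (circleMap_mem_disc h0.le h1 _)]
    · rw [indicator_of_notMem (fun h => h1 h.2)]
      have : ∀ θ, circleMap 0 r θ ∉ disc := fun θ => by
        simpa [disc, abs_of_pos h0] using h1
      simp_rw [indicator_of_notMem (this _)]
      simp
  · rw [indicator_of_notMem (by simpa using h0), indicator_of_notMem (fun h => h0 h.1)]

/-- The integral `∫ |f (r e ^ (i θ))| ^ p dθ` over a full period. -/
noncomputable def circleMean (p : ℝ) (f : ℂ → ℂ) (r : ℝ) : ℝ :=
  ∫ θ in (-Real.pi)..Real.pi, ‖f (circleMap 0 r θ)‖ ^ p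

theorem continuous_comp_circleMap {f : ℂ → ℂ} (hf : ContinuousOn f disc) {r : ℝ} (h0 : 0 ≤ r)
    (h1 : r < 1) : Continuous fun θ => f (circleMap 0 r θ) :=
  hf.comp_continuous (continuous_circleMap 0 r) (circleMap_mem_disc h0 h1)

theorem continuous_norm_comp_circleMap_rpow {p : ℝ} (hp : 0 ≤ p) {f : ℂ → ℂ}
    (hf : ContinuousOn f disc) {r : ℝ} (h0 : 0 ≤ r) (h1 : r < 1) :
    Continuous fun θ => ‖f (circleMap 0 r θ)‖ ^ p :=
  (continuous_comp_circleMap hf h0 h1).norm.rpow_const fun _ => Or.inr hp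

theorem neg_pi_le_pi : -Real.pi ≤ Real.pi := by linarith [Real.pi_pos]

theorem circleMean_nonneg (p : ℝ) (f : ℂ → ℂ) (r : ℝ) : 0 ≤ circleMean p f r :=
  intervalIntegral.integral_nonneg neg_pi_le_pi fun _ _ => by positivity

theorem ofReal_circleMean {p : ℝ} (hp : 0 ≤ p) {f : ℂ → ℂ} (hf : ContinuousOn f disc) {r : ℝ}
    (h0 : 0 ≤ r) (h1 : r < 1) : ENNReal.ofReal (circleMean p f r) =
      ∫⁻ θ in Ioo (-Real.pi) Real.pi, ENNReal.ofReal (‖f (circleMap 0 r θ)‖ ^ p) := by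
  have hc := continuous_norm_comp_circleMap_rpow hp hf h0 h1
  rw [circleMean, intervalIntegral.integral_of_le neg_pi_le_pi, integral_Ioc_eq_integral_Ioo,
    ofReal_integral_eq_lintegral_ofReal
      (hc.integrableOn_Icc.mono_set Ioo_subset_Icc_self) (.of_forall fun _ => by positivity)]

/-- Radially weighted area integrals in terms of the circle means. -/
theorem setLIntegral_disc_mul_radial {p : ℝ} (hp : 0 ≤ p) {f : ℂ → ℂ} (hf : ContinuousOn f disc)
    {W : ℝ → ℝ≥0∞} (hW : Measurable W) :
    ∫⁻ z in disc, W ‖z‖ * ENNReal.ofReal (‖f z‖ ^ p) =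
      ∫⁻ r in Ioo (0 : ℝ) 1, ENNReal.ofReal r * W r * ENNReal.ofReal (circleMean p f r) := by
  have hm : Measurable fun z => W ‖z‖ * ENNReal.ofReal (disc.indicator (fun z => ‖f z‖ ^ p) z) :=
    (hW.comp measurable_norm).mul (measurable_indicator_of_continuousOn measurableSet_disc
      (hf.norm.rpow_const fun _ _ => Or.inr hp)).ennreal_ofReal
  calc _ = ∫⁻ z in disc, W ‖z‖ * ENNReal.ofReal (disc.indicator (fun z => ‖f z‖ ^ p) z) :=
        setLIntegral_congr_fun measurableSet_disc fun z hz => by simp only [indicator_of_mem hz]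
    _ = _ := by
        rw [setLIntegral_disc_eq_polar hm]
        refine setLIntegral_congr_fun measurableSet_Ioo fun r hr => ?_
        have hmc := (continuous_norm_comp_circleMap_rpow hp hf hr.1.le hr.2).measurable.ennreal_ofReal
        rw [ofReal_circleMean hp hf hr.1.le hr.2, mul_assoc, ← lintegral_const_mul (W r) hmc]
        simp_rw [indicator_of_mem (circleMap_mem_disc hr.1.le hr.2 _), norm_circleMap_zero,
          abs_of_pos hr.1]

/-! ### Monotonicity of the integral means in the radius -/

theorem circleMap_zero_rotate (r β θ : ℝ) :
    circleMap 0 r β * Complex.exp (θ * Complex.I) = circleMap 0 r (θ + β) := by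
  simp only [circleMap_zero, mul_assoc, ← Complex.exp_add]
  push_cast; ring_nf

/-- Averages of rotations of an analytic function against a continuous density are analytic. -/
theorem differentiableOn_integral_rotate {f : ℂ → ℂ} (hf : DifferentiableOn ℂ f disc)
    {κ : ℝ → ℂ} (hκ : Continuous κ) (a b : ℝ) :
    DifferentiableOn ℂ
      (fun w => ∫ θ in a..b, f (w * Complex.exp (θ * Complex.I)) * κ θ) disc := by
  intro w₀ hw₀
  have hw₀' : ‖w₀‖ < 1 := by simpa [disc] using hw₀
  obtain ⟨ρ, hρ0, hρ1⟩ := exists_between hw₀'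
  have hρ : 0 < ρ := (norm_nonneg _).trans_lt hρ0
  have hsub : Metric.closedBall (0 : ℂ) ρ ⊆ disc := Metric.closedBall_subset_ball hρ1
  have hdc : ContinuousOn (deriv f) disc := (hf.deriv Metric.isOpen_ball).continuousOn
  obtain ⟨K, hK⟩ := (isCompact_closedBall (0 : ℂ) ρ).exists_bound_of_continuousOn
    (hdc.mono hsub)
  have hmem : ∀ w ∈ Metric.ball (0 : ℂ) ρ, ∀ θ : ℝ,
      w * Complex.exp (θ * Complex.I) ∈ Metric.closedBall (0 : ℂ) ρ := fun w hw θ => by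
    simp only [mem_closedBall_zero_iff, norm_mul, Complex.norm_exp_ofReal_mul_I, mul_one]
    exact (mem_ball_zero_iff.1 hw).le
  have hcont : ∀ {g : ℂ → ℂ}, ContinuousOn g disc → ∀ w ∈ Metric.ball (0 : ℂ) ρ,
      Continuous fun θ : ℝ => g (w * Complex.exp (θ * Complex.I)) := fun hg w hw =>
    hg.comp_continuous (by fun_prop) fun θ => hsub (hmem w hw θ)
  have hball : Metric.ball (0 : ℂ) ρ ∈ 𝓝 w₀ :=
    Metric.isOpen_ball.mem_nhds (mem_ball_zero_iff.2 hρ0)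
  have hw₀b := mem_of_mem_nhds hball
  have h := intervalIntegral.hasDerivAt_integral_of_dominated_loc_of_deriv_le (a := a) (b := b)
    (μ := volume) (F := fun w θ => f (w * Complex.exp (θ * Complex.I)) * κ θ)
    (F' := fun w θ => deriv f (w * Complex.exp (θ * Complex.I)) *
      Complex.exp (θ * Complex.I) * κ θ)
    (bound := fun θ => K * ‖κ θ‖) hball
    (by filter_upwards [hball] with w hw
        exact ((hcont hf.continuousOn w hw).mul hκ).aestronglyMeasurable)
    (((hcont hf.continuousOn w₀ hw₀b).mul hκ).intervalIntegrable _ _)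
    (((hcont hdc w₀ hw₀b).mul (by fun_prop)).mul hκ).aestronglyMeasurable
    (.of_forall fun θ _ w hw => by
      simp only [norm_mul, Complex.norm_exp_ofReal_mul_I, mul_one]
      exact mul_le_mul_of_nonneg_right (hK _ (hmem w hw θ)) (norm_nonneg _))
    ((continuous_const.mul hκ.norm).intervalIntegrable _ _)
    (.of_forall fun θ _ w hw => by
      have h1 : HasDerivAt f (deriv f (w * Complex.exp (θ * Complex.I)))
          (w * Complex.exp (θ * Complex.I)) :=
        (hf.differentiableAt (Metric.isOpen_ball.mem_nhds (hsub (hmem w hw θ)))).hasDerivAt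
      have h2 : HasDerivAt (fun w : ℂ => w * Complex.exp (θ * Complex.I))
          (Complex.exp (θ * Complex.I)) w := by
        simpa using (hasDerivAt_id w).mul_const (Complex.exp (θ * Complex.I))
      exact (h1.comp w h2).mul_const _)
  exact h.2.differentiableAt.differentiableWithinAt

theorem circleMean_rotate (p : ℝ) (f : ℂ → ℂ) (r β : ℝ) :
    ∫ θ in (-Real.pi)..Real.pi, ‖f (circleMap 0 r (θ + β))‖ ^ p = circleMean p f r := by
  have hper : Function.Periodic (fun θ => ‖f (circleMap 0 r θ)‖ ^ p) (2 * Real.pi) := fun θ => by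
    simp only [periodic_circleMap 0 r θ]
  rw [intervalIntegral.integral_comp_add_right (fun θ => ‖f (circleMap 0 r θ)‖ ^ p), circleMean]
  have := hper.intervalIntegral_add_eq (-Real.pi + β) (-Real.pi)
  rw [show -Real.pi + β + 2 * Real.pi = Real.pi + β by ring,
    show -Real.pi + 2 * Real.pi = Real.pi by ring] at this
  exact this

/-- The integral means of an analytic function increase with the radius. -/
theorem circleMean_mono {p : ℝ} (hp : 2 < p) {f : ℂ → ℂ} (hf : DifferentiableOn ℂ f disc)
    {r R : ℝ} (h0 : 0 ≤ r) (hrR : r ≤ R) (hR : R < 1) : circleMean p f r ≤ circleMean p f R := by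
  have hfc := hf.continuousOn
  rcases hrR.eq_or_lt with rfl | hlt
  · exact le_rfl
  have hp0 : 0 < p := by linarith
  have hR0 : 0 < R := h0.trans_lt hlt
  have hr1 : r < 1 := hrR.trans_lt hR
  set u : ℝ → ℂ := fun θ => f (circleMap 0 r θ) with hu
  have huc : Continuous u := continuous_comp_circleMap hfc h0 hr1
  -- The density dual to f on the circle of radius r: f κ = |f|^p there, so the analytic average g
  -- of rotations satisfies g(r) = M(r).
  set κ : ℝ → ℂ := fun θ => ((‖u θ‖ ^ (p - 2) : ℝ) : ℂ) * (starRingEnd ℂ) (u θ) with hκ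
  have hκc : Continuous κ := by
    refine Continuous.mul (Complex.continuous_ofReal.comp
      (huc.norm.rpow_const fun _ => Or.inr (by linarith))) (Complex.continuous_conj.comp huc)
  have hκn : ∀ θ, ‖κ θ‖ = ‖u θ‖ ^ (p - 1) := fun θ => by
    rcases (norm_nonneg (u θ)).eq_or_lt with h | h
    · simp [hκ, ← h, Real.zero_rpow (by linarith : p - 1 ≠ 0)]
    · rw [hκ, norm_mul, Complex.norm_real, Complex.norm_conj, Real.norm_of_nonneg (by positivity),
        show p - 1 = p - 2 + 1 by ring, Real.rpow_add_one h.ne']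
  set g : ℂ → ℂ := fun w =>
    ∫ θ in (-Real.pi)..Real.pi, f (w * Complex.exp (θ * Complex.I)) * κ θ with hg
  have hgd : DifferentiableOn ℂ g disc := differentiableOn_integral_rotate hf hκc _ _
  have hgr : g r = circleMean p f r := by
    rw [circleMean, ← intervalIntegral.integral_ofReal]
    refine intervalIntegral.integral_congr fun θ _ => ?_
    have e1 : (r : ℂ) * Complex.exp (θ * Complex.I) = circleMap 0 r θ := (circleMap_zero r θ).symm
    simp only [e1]
    change u θ * (((‖u θ‖ ^ (p - 2) : ℝ) : ℂ) * (starRingEnd ℂ) (u θ)) = ((‖u θ‖ ^ p : ℝ) : ℂ)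
    rw [mul_left_comm, Complex.mul_conj, Complex.normSq_eq_norm_sq, ← Complex.ofReal_mul]
    congr 1
    rcases (norm_nonneg (u θ)).eq_or_lt with h | h
    · simp [← h, Real.zero_rpow hp0.ne']
    · rw [← Real.rpow_two, ← Real.rpow_add h, sub_add_cancel]
  -- Young's inequality on |z| = R; the maximum principle then gives M(r) ≤ M(R)/p + (1-1/p) M(r).
  have hgR : ∀ z ∈ frontier (Metric.ball (0 : ℂ) R),
      ‖g z‖ ≤ circleMean p f R / p + circleMean p f r * (1 - 1 / p) := by
    intro z hz
    rw [frontier_ball _ hR0.ne'] at hz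
    obtain ⟨β, -, rfl⟩ : z ∈ circleMap 0 R '' Ioc 0 (2 * Real.pi) := by
      rw [image_circleMap_Ioc, abs_of_pos hR0]; exact hz
    have hcR : Continuous fun θ : ℝ => ‖f (circleMap 0 R (θ + β))‖ ^ p :=
      (continuous_norm_comp_circleMap_rpow hp0.le hfc hR0.le hR).comp (continuous_add_const β)
    have hcr := continuous_norm_comp_circleMap_rpow hp0.le hfc h0 hr1
    calc ‖g (circleMap 0 R β)‖
        ≤ ∫ θ in (-Real.pi)..Real.pi,
            (‖f (circleMap 0 R (θ + β))‖ ^ p / p + ‖u θ‖ ^ p * (1 - 1 / p)) := by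
          refine intervalIntegral.norm_integral_le_of_norm_le neg_pi_le_pi
            (.of_forall fun θ _ => ?_) ?_
          · rw [circleMap_zero_rotate, norm_mul, hκn]
            have hq : p.HolderConjugate (p / (p - 1)) :=
              Real.HolderConjugate.conjExponent (by linarith)
            have := Real.young_inequality_of_nonneg
              (norm_nonneg (f (circleMap 0 R (θ + β))))
              (Real.rpow_nonneg (norm_nonneg (u θ)) (p - 1)) hq
            rw [← Real.rpow_mul (norm_nonneg _),
              mul_div_cancel₀ p (by linarith : p - 1 ≠ 0)] at this
            refine this.trans (le_of_eq ?_)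
            have : p - 1 ≠ 0 := by linarith
            field_simp
          · exact ((hcR.div_const p).add (hcr.mul_const _)).intervalIntegrable _ _
      _ = _ := by
          rw [intervalIntegral.integral_add ((hcR.div_const p).intervalIntegrable _ _)
            ((hcr.mul_const _).intervalIntegrable _ _), intervalIntegral.integral_div,
            intervalIntegral.integral_mul_const, circleMean_rotate]
          rfl
  have hdiff : DiffContOnCl ℂ g (Metric.ball 0 R) :=
    (hgd.mono (Metric.closedBall_subset_ball hR)).diffContOnCl_ball subset_rfl
  have hmax := Complex.norm_le_of_forall_mem_frontier_norm_le Metric.isBounded_ball hdiff hgR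
    (z := (r : ℂ)) (by
      rw [closure_ball _ hR0.ne']
      simpa [abs_of_nonneg h0] using hrR)
  rw [hgr, Complex.norm_real, Real.norm_of_nonneg (circleMean_nonneg ..)] at hmax
  have hfin : circleMean p f r / p ≤ circleMean p f R / p := by
    have : circleMean p f r * (1 - 1 / p) = circleMean p f r - circleMean p f r / p := by ring
    linarith
  exact (div_le_div_iff_of_pos_right hp0).1 hfin

/-! ### Taylor coefficients of Bergman functions -/

theorem MemBergman.differentiableOn {p : ℝ} {f : ℂ → ℂ} (hf : MemBergman p f) :
    DifferentiableOn ℂ f disc := hf.1.differentiableOn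

/-- Cauchy's integral formula for derivatives, rewritten on [0, 2π]. -/
theorem fourierCoeffOn_circleMap {f : ℂ → ℂ} (hf : DifferentiableOn ℂ f disc) {r : ℝ}
    (h0 : 0 < r) (h1 : r < 1) (n : ℕ) :
    fourierCoeffOn Real.two_pi_pos (fun θ => f (circleMap 0 r θ)) n =
      taylorCoeff f n * (r : ℂ) ^ n := by
  have hr : (r : ℂ) ≠ 0 := by exact_mod_cast h0.ne'
  have hc := (hf.mono (Metric.closedBall_subset_ball h1)).circleIntegral_one_div_sub_center_pow_smul
    h0 n
  have hpi : (Real.pi : ℂ) ≠ 0 := by exact_mod_cast Real.pi_ne_zero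
  have e : ∀ θ : ℝ, deriv (circleMap 0 r) θ •
      ((1 / (circleMap 0 r θ - 0) ^ (n + 1)) • f (circleMap 0 r θ)) =
      Complex.I * ((r : ℂ) ^ n)⁻¹ *
      (fourier (-(n : ℤ)) (θ : AddCircle (2 * Real.pi - 0)) • f (circleMap 0 r θ)) := fun θ => by
    rw [fourier_coe_apply]
    have e2 : (2 * (Real.pi : ℂ) * Complex.I * ((-(n : ℤ) : ℤ) : ℂ) * θ /
        ((2 * Real.pi - 0 : ℝ) : ℂ)) = -(n * (θ * Complex.I)) := by
      push_cast; field_simp; ring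
    have e3 : Complex.exp (θ * Complex.I) ≠ 0 := Complex.exp_ne_zero _
    rw [e2, Complex.exp_neg, Complex.exp_nat_mul, deriv_circleMap, circleMap_zero, sub_zero]
    simp only [smul_eq_mul]
    field_simp
    ring
  rw [circleIntegral] at hc
  simp_rw [e] at hc
  rw [intervalIntegral.integral_const_mul] at hc
  rw [fourierCoeffOn_eq_integral, taylorCoeff]
  have hI := Complex.I_ne_zero
  have hrn : (r : ℂ) ^ n ≠ 0 := pow_ne_zero _ hr
  have hn : ((n ! : ℕ) : ℂ) ≠ 0 := by exact_mod_cast n.factorial_ne_zero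
  set X := ∫ θ in (0 : ℝ)..2 * Real.pi,
    fourier (-(n : ℤ)) (θ : AddCircle (2 * Real.pi - 0)) • f (circleMap 0 r θ) with hX
  have hXe : X = (2 * Real.pi) * (r : ℂ) ^ n * (iteratedDeriv n f 0 / (n ! : ℕ)) := by
    simp only [smul_eq_mul] at hc
    field_simp at hc ⊢
    linear_combination hc
  rw [hXe, Complex.real_smul]
  push_cast
  field_simp
  ring

theorem sum_sq_taylorCoeff_le {f : ℂ → ℂ} (hf : DifferentiableOn ℂ f disc) {r : ℝ}
    (h0 : 0 < r) (h1 : r < 1) (N : ℕ) :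
    ∑ k ∈ Finset.range N, (‖taylorCoeff f k‖ * r ^ k) ^ 2 ≤
      (2 * Real.pi)⁻¹ * circleMean 2 f r := by
  have hc := continuous_comp_circleMap hf.continuousOn h0.le h1
  have hL2 : MemLp (fun θ => f (circleMap 0 r θ)) 2 (volume.restrict (Ioc 0 (2 * Real.pi))) := by
    obtain ⟨K, hK⟩ := (isCompact_Icc (a := (0 : ℝ)) (b := 2 * Real.pi)).exists_bound_of_continuousOn
      hc.continuousOn
    exact MemLp.of_bound hc.aestronglyMeasurable K ((ae_restrict_iff' measurableSet_Ioc).2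
      (.of_forall fun θ hθ => hK θ (Ioc_subset_Icc_self hθ)))
  have h := hasSum_sq_fourierCoeffOn Real.two_pi_pos hL2
  have hle := sum_le_hasSum ((Finset.range N).map Nat.castEmbedding) (fun _ _ => sq_nonneg _) h
  rw [Finset.sum_map] at hle
  have e : ∫ θ in (0 : ℝ)..2 * Real.pi, ‖f (circleMap 0 r θ)‖ ^ 2 = circleMean 2 f r := by
    rw [← circleMean_rotate 2 f r Real.pi,
      intervalIntegral.integral_comp_add_right (fun θ => ‖f (circleMap 0 r θ)‖ ^ (2 : ℝ))]
    simp [two_mul]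
  rw [e, sub_zero, smul_eq_mul] at hle
  refine le_trans (le_of_eq (Finset.sum_congr rfl fun k _ => ?_)) hle
  rw [Nat.castEmbedding_apply]
  rw [fourierCoeffOn_circleMap hf h0 h1, norm_mul, norm_pow, Complex.norm_real,
    Real.norm_of_nonneg h0.le]

theorem circleMean_two_le {p : ℝ} (hp : 2 < p) {f : ℂ → ℂ} (hf : ContinuousOn f disc) {r A : ℝ}
    (h0 : 0 ≤ r) (h1 : r < 1) (hA : 0 < A) (h : (2 * Real.pi)⁻¹ * circleMean p f r ≤ A) :
    (2 * Real.pi)⁻¹ * circleMean 2 f r ≤ A ^ (2 / p) := by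
  have hp0 : 0 < p := by linarith
  have hα1 : 2 / p ≤ 1 := by rw [div_le_one hp0]; exact hp.le
  have hcp := continuous_norm_comp_circleMap_rpow hp0.le hf h0 h1
  -- The tangent line at y = A of the concave y^(2/p), taken at y = x^p; integrating it replaces
  -- Jensen's inequality.
  have hpt : ∀ x : ℝ, 0 ≤ x → x ^ (2 : ℝ) ≤
      A ^ (2 / p) * (1 - 2 / p) + A ^ (2 / p) * (2 / p / A) * x ^ p := by
    intro x hx
    have hB := rpow_one_add_le_one_add_mul_self (s := x ^ p / A - 1)
      (by linarith [div_nonneg (Real.rpow_nonneg hx p) hA.le]) (by positivity) hα1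
    rw [add_sub_cancel, Real.div_rpow (Real.rpow_nonneg hx p) hA.le, ← Real.rpow_mul hx,
      mul_div_cancel₀ _ hp0.ne', div_le_iff₀ (by positivity)] at hB
    refine hB.trans (le_of_eq ?_)
    ring
  have hle : circleMean 2 f r ≤ ∫ θ in (-Real.pi)..Real.pi,
      (A ^ (2 / p) * (1 - 2 / p) + A ^ (2 / p) * (2 / p / A) * ‖f (circleMap 0 r θ)‖ ^ p) := by
    refine intervalIntegral.integral_mono neg_pi_le_pi
      ((continuous_norm_comp_circleMap_rpow zero_le_two hf h0 h1).intervalIntegrable _ _)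
      ((continuous_const.add (continuous_const.mul hcp)).intervalIntegrable _ _) fun θ => ?_
    exact hpt _ (norm_nonneg _)
  have hci : IntervalIntegrable
      (fun θ => A ^ (2 / p) * (2 / p / A) * ‖f (circleMap 0 r θ)‖ ^ p) volume
      (-Real.pi) Real.pi := (continuous_const.mul hcp).intervalIntegrable _ _
  rw [intervalIntegral.integral_add (by simp) hci, intervalIntegral.integral_const,
    intervalIntegral.integral_const_mul] at hle
  change circleMean 2 f r ≤ _ + _ * circleMean p f r at hle
  rw [inv_mul_le_iff₀ Real.two_pi_pos] at h ⊢
  have hApos : 0 < A ^ (2 / p) := by positivity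
  have h2 : A ^ (2 / p) * (2 / p / A) * circleMean p f r ≤
      A ^ (2 / p) * (2 / p / A) * (2 * Real.pi * A) :=
    mul_le_mul_of_nonneg_left h (by positivity)
  have h3 : A ^ (2 / p) * (2 / p / A) * (2 * Real.pi * A) =
      A ^ (2 / p) * (2 / p) * (2 * Real.pi) := by field_simp
  rw [h3] at h2
  simp only [smul_eq_mul] at hle
  linarith

theorem ofReal_integral_bergman {p : ℝ} {f : ℂ → ℂ} (hf : MemBergman p f) :
    ENNReal.ofReal (∫ z in disc, ‖f z‖ ^ p) = ∫⁻ z in disc, ENNReal.ofReal (‖f z‖ ^ p) :=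
  ofReal_integral_eq_lintegral_ofReal hf.2 (.of_forall fun _ => by positivity)

/-- The growth of the integral means of Bergman functions. -/
theorem circleMean_le {p : ℝ} (hp : 2 < p) {f : ℂ → ℂ} (hf : MemBergman p f) {r : ℝ}
    (h0 : 0 < r) (h1 : r < 1) :
    circleMean p f r * ((1 - r ^ 2) / 2) ≤ ∫ z in disc, ‖f z‖ ^ p := by
  have hp0 : 0 ≤ p := by linarith
  have hnn : 0 ≤ ∫ z in disc, ‖f z‖ ^ p := integral_nonneg fun _ => by positivity
  rw [← ENNReal.ofReal_le_ofReal_iff hnn, ofReal_integral_bergman hf]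
  have hpol := setLIntegral_disc_mul_radial hp0 hf.differentiableOn.continuousOn
    (W := fun _ => 1) measurable_const
  simp only [one_mul, mul_one] at hpol
  rw [hpol, ENNReal.ofReal_mul (circleMean_nonneg ..), mul_comm]
  have hI := lintegral_rpow_Ioo (a := 2) two_pos ⟨h0.le, h1⟩
  rw [Real.rpow_two] at hI
  rw [← hI, ← lintegral_mul_const' _ _ ENNReal.ofReal_ne_top]
  refine (setLIntegral_mono' measurableSet_Ioo fun s hs => ?_).trans
    (lintegral_mono_set (Ioo_subset_Ioo_left h0.le))
  rw [show (2 : ℝ) - 1 = 1 by norm_num, Real.rpow_one]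
  gcongr
  exact circleMean_mono hp hf.differentiableOn h0.le hs.1.le hs.2

/-- The mean of |f|^p is O(1/(1-r²)), so that of |f|² is O((1-r²)^(-2/p)). Bessel and Cauchy–Schwarz
against a geometric series, which costs (1-ρ)^(-1/2), give the exponent. -/
theorem sum_taylorCoeff_mul_pow_le {p : ℝ} (hp : 2 < p) {f : ℂ → ℂ} (hf : MemBergman p f) :
    ∃ C : ℝ, ∀ ρ ∈ Ioo (0 : ℝ) 1, ∀ N : ℕ,
      ∑ k ∈ Finset.range N, ‖taylorCoeff f k‖ * ρ ^ k ≤ C * (1 - ρ) ^ (-((2 / p + 1) / 2)) := by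
  set J := ∫ z in disc, ‖f z‖ ^ p with hJ
  have hJ0 : 0 ≤ J := integral_nonneg fun _ => by positivity
  -- Adding 1 keeps C positive even for f = 0.
  set C := J + 1 with hC
  refine ⟨Real.sqrt (C ^ (2 / p)), fun ρ hρ N => ?_⟩
  have h1ρ : 0 < 1 - ρ := by linarith [hρ.2]
  -- With r² = ρ, each ρ^k splits as r^k · r^k for Cauchy–Schwarz.
  set r := Real.sqrt ρ with hr
  have hr0 : 0 < r := Real.sqrt_pos.2 hρ.1
  have hr1 : r < 1 := by rw [hr, Real.sqrt_lt' one_pos]; simpa using hρ.2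
  have hr2 : r ^ 2 = ρ := Real.sq_sqrt hρ.1.le
  have hA : 0 < C / (1 - ρ) := by positivity
  have hmean := circleMean_two_le hp hf.differentiableOn.continuousOn hr0.le hr1 hA (by
    have := circleMean_le hp hf hr0 hr1
    rw [hr2, ← hJ] at this
    rw [le_div_iff₀ h1ρ, mul_assoc, inv_mul_le_iff₀ Real.two_pi_pos]
    nlinarith [Real.pi_gt_three])
  have hbes := (sum_sq_taylorCoeff_le hf.differentiableOn hr0 hr1 N).trans hmean
  have hgeo : ∑ k ∈ Finset.range N, (r ^ k) ^ 2 ≤ (1 - ρ)⁻¹ := by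
    simp_rw [← pow_mul, mul_comm _ 2, pow_mul, hr2]
    rw [← tsum_geometric_of_lt_one hρ.1.le hρ.2]
    exact (summable_geometric_of_lt_one hρ.1.le hρ.2).sum_le_tsum _ fun _ _ =>
      pow_nonneg hρ.1.le _
  calc ∑ k ∈ Finset.range N, ‖taylorCoeff f k‖ * ρ ^ k
      = ∑ k ∈ Finset.range N, (‖taylorCoeff f k‖ * r ^ k) * r ^ k := by
        refine Finset.sum_congr rfl fun k _ => ?_
        rw [mul_assoc, ← mul_pow, ← sq, hr2]
    _ ≤ Real.sqrt (∑ k ∈ Finset.range N, (‖taylorCoeff f k‖ * r ^ k) ^ 2) *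
        Real.sqrt (∑ k ∈ Finset.range N, (r ^ k) ^ 2) := Real.sum_mul_le_sqrt_mul_sqrt _ _ _
    _ ≤ Real.sqrt ((C / (1 - ρ)) ^ (2 / p)) * Real.sqrt ((1 - ρ)⁻¹) := by gcongr
    _ = _ := by
        rw [Real.div_rpow (by positivity) h1ρ.le, div_eq_mul_inv, Real.sqrt_mul (by positivity),
          mul_assoc, ← Real.sqrt_mul (by positivity), ← Real.rpow_neg h1ρ.le,
          ← Real.rpow_neg_one (1 - ρ), ← Real.rpow_add h1ρ, Real.sqrt_eq_rpow (_ ^ (_ + _)),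
          ← Real.rpow_mul h1ρ.le]
        ring_nf

/-- The series `∑ |aₖ| / (k + 1)` of a Bergman function converges. -/
theorem summable_norm_taylorCoeff_div {p : ℝ} (hp : 2 < p) {f : ℂ → ℂ} (hf : MemBergman p f) :
    Summable fun k : ℕ => ‖taylorCoeff f k‖ / (k + 1) := by
  obtain ⟨C, hC⟩ := sum_taylorCoeff_mul_pow_le hp hf
  have hp0 : 0 < p := by linarith
  have hα1 : 2 / p < 1 := by rw [div_lt_one hp0]; exact hp
  -- Since 2/p < 1 the power of 1-ρ exceeds -1; integrating the previous bound over ρ produces the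
  -- factors 1/(k+1).
  have hint : IntegrableOn (fun ρ : ℝ => C * (1 - ρ) ^ (-((2 / p + 1) / 2))) (Ioo 0 1) := by
    have := integrableOn_rpow_mul_one_sub_rpow (u := 1) (v := 1 - (2 / p + 1) / 2) one_pos
      (by linarith)
    refine IntegrableOn.congr_fun (this.const_mul C) (fun t _ => ?_) measurableSet_Ioo
    simp [sub_sub_cancel_left]
  refine summable_of_sum_range_le (c := ∫ ρ in Ioo (0 : ℝ) 1, C * (1 - ρ) ^ (-((2 / p + 1) / 2)))
    (fun _ => by positivity) fun N => ?_
  have e : ∑ k ∈ Finset.range N, ‖taylorCoeff f k‖ / (k + 1) =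
      ∫ ρ in Ioo (0 : ℝ) 1, ∑ k ∈ Finset.range N, ‖taylorCoeff f k‖ * ρ ^ k := by
    rw [← integral_Ioc_eq_integral_Ioo, ← intervalIntegral.integral_of_le zero_le_one,
      intervalIntegral.integral_finsetSum fun k _ =>
        (by fun_prop : Continuous fun ρ : ℝ => ‖taylorCoeff f k‖ * ρ ^ k).intervalIntegrable _ _]
    refine Finset.sum_congr rfl fun k _ => ?_
    rw [intervalIntegral.integral_const_mul, integral_pow]
    simp [div_eq_mul_inv]
  rw [e]
  refine setIntegral_mono_on ?_ hint measurableSet_Ioo fun ρ hρ => hC ρ hρ N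
  exact ((by fun_prop : Continuous fun ρ : ℝ => ∑ k ∈ Finset.range N,
    ‖taylorCoeff f k‖ * ρ ^ k).integrableOn_Icc).mono_set Ioo_subset_Icc_self

/-! ### The integral representation of the Hilbert matrix operator -/

/-- The weight `1 / ((t - 1) z + 1)`. -/
noncomputable def compWeight (t : ℝ) (z : ℂ) : ℂ := 1 / (((t : ℂ) - 1) * z + 1)

/-- The self-map `z ↦ t / ((t - 1) z + 1)` of the disc. -/
noncomputable def compMap (t : ℝ) (z : ℂ) : ℂ := (t : ℂ) / (((t : ℂ) - 1) * z + 1)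

theorem mem_disc {z : ℂ} : z ∈ disc ↔ ‖z‖ < 1 := by simp [disc]

theorem one_sub_le_norm_denom {t : ℝ} (ht : t ≤ 1) (z : ℂ) :
    1 - (1 - t) * ‖z‖ ≤ ‖((t : ℂ) - 1) * z + 1‖ := by
  have h := norm_sub_norm_le (1 : ℂ) ((1 - (t : ℂ)) * z)
  have e : ‖(1 - (t : ℂ)) * z‖ = (1 - t) * ‖z‖ := by
    rw [norm_mul, ← Complex.ofReal_one, ← Complex.ofReal_sub, Complex.norm_real,
      Real.norm_of_nonneg (by linarith)]
  rw [norm_one, e, show 1 - (1 - (t : ℂ)) * z = ((t : ℂ) - 1) * z + 1 by ring] at h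
  exact h

theorem one_sub_norm_le_norm_denom {t : ℝ} (h0 : 0 ≤ t) (h1 : t ≤ 1) (z : ℂ) :
    1 - ‖z‖ ≤ ‖((t : ℂ) - 1) * z + 1‖ := by
  have := one_sub_le_norm_denom h1 z
  nlinarith [norm_nonneg z]

theorem denom_ne_zero {t : ℝ} (h0 : 0 ≤ t) (h1 : t ≤ 1) {z : ℂ} (hz : z ∈ disc) :
    ((t : ℂ) - 1) * z + 1 ≠ 0 := by
  have := one_sub_norm_le_norm_denom h0 h1 z
  rw [mem_disc] at hz
  exact norm_pos_iff.1 (by linarith)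

/-- A majorant affine in t, whose k-th powers integrate to O(1/(k+1)). -/
theorem norm_compMap_le {t : ℝ} (h0 : 0 ≤ t) (h1 : t ≤ 1) {z : ℂ} (hz : z ∈ disc) :
    ‖compMap t z‖ ≤ ‖z‖ + (1 - ‖z‖) * t := by
  have hd := one_sub_le_norm_denom h1 z
  rw [mem_disc] at hz
  have hz0 := norm_nonneg z
  rw [compMap, norm_div, Complex.norm_real, Real.norm_of_nonneg h0,
    div_le_iff₀ (by nlinarith)]
  have h2 : 0 ≤ ‖z‖ + (1 - ‖z‖) * t := by nlinarith
  have h3 := mul_le_mul_of_nonneg_left hd h2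
  nlinarith [mul_nonneg (mul_nonneg hz0 (sub_nonneg.2 hz.le)) (sq_nonneg (1 - t))]

theorem compMap_mem_disc {t : ℝ} (h0 : 0 ≤ t) (h1 : t < 1) {z : ℂ} (hz : z ∈ disc) :
    compMap t z ∈ disc := by
  have := norm_compMap_le h0 h1.le hz
  rw [mem_disc] at hz ⊢
  nlinarith

theorem norm_compWeight_le {t : ℝ} (h0 : 0 ≤ t) (h1 : t ≤ 1) {z : ℂ} (hz : z ∈ disc) :
    ‖compWeight t z‖ ≤ (1 - ‖z‖)⁻¹ := by
  rw [compWeight, norm_div, norm_one, one_div]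
  rw [mem_disc] at hz
  exact inv_anti₀ (by linarith) (one_sub_norm_le_norm_denom h0 h1 z)

theorem continuousOn_compMap {z : ℂ} (hz : z ∈ disc) :
    ContinuousOn (fun t => compMap t z) (Icc 0 1) := by
  unfold compMap
  exact ContinuousOn.div (by fun_prop) (by fun_prop) fun t ht => denom_ne_zero ht.1 ht.2 hz

theorem continuousOn_compWeight {z : ℂ} (hz : z ∈ disc) :
    ContinuousOn (fun t => compWeight t z) (Icc 0 1) := by
  unfold compWeight
  exact ContinuousOn.div (by fun_prop) (by fun_prop) fun t ht => denom_ne_zero ht.1 ht.2 hz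

theorem one_sub_mul_ne_zero {t : ℝ} (h0 : 0 ≤ t) (h1 : t ≤ 1) {z : ℂ} (hz : z ∈ disc) :
    1 - (t : ℂ) * z ≠ 0 := by
  have := denom_ne_zero (t := 1 - t) (by linarith) (by linarith) hz
  push_cast at this
  convert! this using 1
  ring

/-- Both sides integrate w^k / (1-wz) dw from 0 to 1, on the left along the path t ↦ φ_t(z) and on
the right along the segment. The integrand has a primitive on a disc containing both paths. -/
theorem integral_compMap_pow_mul_compWeight {z : ℂ} (hz : z ∈ disc) (k : ℕ) :
    ∫ t in (0 : ℝ)..1, compMap t z ^ k * compWeight t z =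
      ∫ t in (0 : ℝ)..1, (t : ℂ) ^ k / (1 - t * z) := by
  have hz' := mem_disc.1 hz
  have hz0 := norm_nonneg z
  -- The radius 2/(1+‖z‖) exceeds 1, yet keeps ‖wz‖ < 1.
  have hden : ∀ w ∈ Metric.ball (0 : ℂ) (2 / (1 + ‖z‖)), 1 - w * z ≠ 0 := by
    intro w hw h
    rw [mem_ball_zero_iff, lt_div_iff₀ (by positivity)] at hw
    have : ‖w * z‖ = 1 := by rw [← sub_eq_zero.1 h, norm_one]
    rw [norm_mul] at this
    nlinarith [norm_nonneg w]
  have hdiff : DifferentiableOn ℂ (fun w : ℂ => w ^ k / (1 - w * z))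
      (Metric.ball 0 (2 / (1 + ‖z‖))) :=
    DifferentiableOn.div (by fun_prop) (by fun_prop) hden
  obtain ⟨P, hP⟩ := hdiff.isExactOn_ball
  have hsub : ∀ w : ℂ, ‖w‖ ≤ 1 → w ∈ Metric.ball (0 : ℂ) (2 / (1 + ‖z‖)) := fun w hw => by
    rw [mem_ball_zero_iff, lt_div_iff₀ (by positivity)]; nlinarith
  have h1z : 1 - z ≠ 0 := by
    have := one_sub_mul_ne_zero (t := 1) zero_le_one le_rfl hz
    simpa using this
  have hL : ∫ t in (0 : ℝ)..1, compMap t z ^ k * compWeight t z = P 1 - P 0 := by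
    have := intervalIntegral.integral_eq_sub_of_hasDerivAt (a := 0) (b := 1)
      (f := fun t : ℝ => P (compMap t z)) (f' := fun t => compMap t z ^ k * compWeight t z) ?_ ?_
    · rw [this]; simp [compMap]
    · intro t ht
      rw [uIcc_of_le zero_le_one] at ht
      have hd := denom_ne_zero ht.1 ht.2 hz
      have hm : ‖compMap t z‖ ≤ 1 := (norm_compMap_le ht.1 ht.2 hz).trans (by nlinarith [ht.2])
      have h1 : HasDerivAt (fun τ : ℂ => τ / ((τ - 1) * z + 1))
          ((1 - z) / (((t : ℂ) - 1) * z + 1) ^ 2) (t : ℂ) := by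
        have := (hasDerivAt_id (t : ℂ)).div
          ((((hasDerivAt_id (t : ℂ)).sub_const 1).mul_const z).add_const 1) hd
        convert! this using 1
        simp; ring
      have h2 := (HasDerivAt.comp (t : ℂ) (hP _ (hsub _ hm)) h1).comp_ofReal
      convert! h2 using 1
      rw [compMap, compWeight]
      have h3 : 1 - (t : ℂ) / (((t : ℂ) - 1) * z + 1) * z = (1 - z) / (((t : ℂ) - 1) * z + 1) := by
        field_simp; ring
      beta_reduce
      rw [h3]
      field_simp
    · rw [intervalIntegrable_iff_integrableOn_Icc_of_le zero_le_one]
      exact (((continuousOn_compMap hz).pow k).mul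
        (continuousOn_compWeight hz)).integrableOn_Icc
  have hR : ∫ t in (0 : ℝ)..1, (t : ℂ) ^ k / (1 - t * z) = P 1 - P 0 := by
    have := intervalIntegral.integral_eq_sub_of_hasDerivAt (a := 0) (b := 1)
      (f := fun t : ℝ => P t) (f' := fun t : ℝ => (t : ℂ) ^ k / (1 - t * z)) ?_ ?_
    · rw [this]; simp
    · intro t ht
      rw [uIcc_of_le zero_le_one] at ht
      exact (hP t (hsub _ (by
        rw [Complex.norm_real, Real.norm_of_nonneg ht.1]; exact ht.2))).comp_ofReal
    · rw [intervalIntegrable_iff_integrableOn_Icc_of_le zero_le_one]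
      refine ContinuousOn.integrableOn_Icc ?_
      exact ContinuousOn.div (by fun_prop) (by fun_prop) fun t ht =>
        one_sub_mul_ne_zero ht.1 ht.2 hz
  rw [hL, hR]

theorem hasSum_pow_div {z : ℂ} (hz : z ∈ disc) (k : ℕ) :
    HasSum (fun n : ℕ => z ^ n / ((n : ℂ) + k + 1))
      (∫ t in (0 : ℝ)..1, (t : ℂ) ^ k / (1 - t * z)) := by
  have hz' := mem_disc.1 hz
  have hbound : ∀ n : ℕ, ∀ t ∈ Ioc (0 : ℝ) 1, ‖(t : ℂ) ^ k * ((t : ℂ) * z) ^ n‖ ≤ ‖z‖ ^ n := by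
    intro n t ht
    rw [norm_mul, norm_pow, norm_pow, norm_mul, Complex.norm_real, Real.norm_of_nonneg ht.1.le]
    have h1 : t ^ k ≤ 1 := pow_le_one₀ ht.1.le ht.2
    have h2 : (t * ‖z‖) ^ n ≤ ‖z‖ ^ n :=
      pow_le_pow_left₀ (mul_nonneg ht.1.le (norm_nonneg z))
        (mul_le_of_le_one_left (norm_nonneg z) ht.2) n
    exact (mul_le_of_le_one_left (pow_nonneg (mul_nonneg ht.1.le (norm_nonneg z)) n) h1).trans h2
  have hlim : ∀ t ∈ Ioc (0 : ℝ) 1, HasSum (fun n : ℕ => (t : ℂ) ^ k * ((t : ℂ) * z) ^ n)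
      ((t : ℂ) ^ k / (1 - t * z)) := by
    intro t ht
    have h1 : ‖(t : ℂ) * z‖ < 1 := by
      rw [norm_mul, Complex.norm_real, Real.norm_of_nonneg ht.1.le]
      nlinarith [norm_nonneg z, ht.1, ht.2]
    rw [div_eq_mul_inv]
    exact (hasSum_geometric_of_norm_lt_one h1).mul_left _
  have e : ∀ n : ℕ, ∫ t in (0 : ℝ)..1, (t : ℂ) ^ k * ((t : ℂ) * z) ^ n =
      z ^ n / ((n : ℂ) + k + 1) := by
    intro n
    have e : ∀ t : ℝ, (t : ℂ) ^ k * ((t : ℂ) * z) ^ n = z ^ n * ((t ^ (n + k) : ℝ) : ℂ) :=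
      fun t => by push_cast; ring
    simp_rw [e]
    rw [intervalIntegral.integral_const_mul, intervalIntegral.integral_ofReal, integral_pow]
    push_cast
    simp [div_eq_mul_inv]
  have h := intervalIntegral.hasSum_integral_of_dominated_convergence (a := 0) (b := 1)
    (μ := volume) (F := fun (n : ℕ) (t : ℝ) => (t : ℂ) ^ k * ((t : ℂ) * z) ^ n)
    (f := fun t : ℝ => (t : ℂ) ^ k / (1 - t * z)) (fun n _ => ‖z‖ ^ n)
    (fun n => (by fun_prop : Continuous fun t : ℝ =>
      (t : ℂ) ^ k * ((t : ℂ) * z) ^ n).aestronglyMeasurable)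
    (fun n => .of_forall fun t ht => hbound n t (by rwa [uIoc_of_le zero_le_one] at ht))
    (.of_forall fun t _ => summable_geometric_of_lt_one (norm_nonneg z) hz')
    intervalIntegrable_const
    (.of_forall fun t ht => hlim t (by rwa [uIoc_of_le zero_le_one] at ht))
  simpa only [e] using h

theorem norm_natCast_add_one (n k : ℕ) : ‖(n : ℂ) + k + 1‖ = n + k + 1 := by
  rw [show (n : ℂ) + k + 1 = ((n + k + 1 : ℕ) : ℂ) by push_cast; ring, Complex.norm_natCast]
  push_cast; ring

theorem norm_taylorCoeff_div_le (f : ℂ → ℂ) (n k : ℕ) :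
    ‖taylorCoeff f k / ((n : ℂ) + k + 1)‖ ≤ ‖taylorCoeff f k‖ / (k + 1) := by
  rw [norm_div, norm_natCast_add_one]
  have : (0 : ℝ) ≤ n := n.cast_nonneg
  gcongr
  linarith

/-! ### Interchanging sums and integrals -/

section

variable {f : ℂ → ℂ}

theorem summable_hilbertCoeff_terms (hs : Summable fun k : ℕ => ‖taylorCoeff f k‖ / (k + 1))
    (n : ℕ) : Summable fun k : ℕ => taylorCoeff f k / ((n : ℂ) + k + 1) :=
  Summable.of_norm_bounded hs (norm_taylorCoeff_div_le f n)

theorem norm_hilbertCoeff_le (hs : Summable fun k : ℕ => ‖taylorCoeff f k‖ / (k + 1)) (n : ℕ) :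
    ‖hilbertCoeff f n‖ ≤ ∑' k : ℕ, ‖taylorCoeff f k‖ / (k + 1) :=
  tsum_of_norm_bounded hs.hasSum (norm_taylorCoeff_div_le f n)

theorem summable_hilbertCoeff_mul_pow
    (hs : Summable fun k : ℕ => ‖taylorCoeff f k‖ / (k + 1)) {z : ℂ} (hz : z ∈ disc) :
    Summable fun n : ℕ => hilbertCoeff f n * z ^ n := by
  refine Summable.of_norm_bounded ((summable_geometric_of_lt_one (norm_nonneg z)
    (mem_disc.1 hz)).mul_left (∑' k : ℕ, ‖taylorCoeff f k‖ / (k + 1))) fun n => ?_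
  rw [norm_mul, norm_pow]
  exact mul_le_mul_of_nonneg_right (norm_hilbertCoeff_le hs n) (by positivity)

theorem differentiableOn_hilbertOp
    (hs : Summable fun k : ℕ => ‖taylorCoeff f k‖ / (k + 1)) :
    DifferentiableOn ℂ (hilbertOp f) disc := by
  intro z hz
  obtain ⟨ρ, hρ0, hρ1⟩ := exists_between (mem_disc.1 hz)
  have hρ : 0 ≤ ρ := (norm_nonneg z).trans hρ0.le
  have h : DifferentiableOn ℂ (hilbertOp f) (Metric.ball 0 ρ) := by
    unfold hilbertOp
    refine Complex.differentiableOn_tsum_of_summable_norm ((summable_geometric_of_lt_one hρ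
      hρ1).mul_left (∑' k : ℕ, ‖taylorCoeff f k‖ / (k + 1)))
      (fun n => by fun_prop) Metric.isOpen_ball fun n w hw => ?_
    rw [norm_mul, norm_pow]
    have := (mem_ball_zero_iff.1 hw).le
    have h2 := norm_hilbertCoeff_le hs n
    have h3 : 0 ≤ ∑' k : ℕ, ‖taylorCoeff f k‖ / (k + 1) := (norm_nonneg _).trans h2
    gcongr
  exact (h.differentiableAt (Metric.isOpen_ball.mem_nhds
    (mem_ball_zero_iff.2 hρ0))).differentiableWithinAt

theorem hilbertOp_eq_tsum_integral
    (hs : Summable fun k : ℕ => ‖taylorCoeff f k‖ / (k + 1)) {z : ℂ} (hz : z ∈ disc) :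
    hilbertOp f z =
      ∑' k : ℕ, taylorCoeff f k * ∫ t in (0 : ℝ)..1, compMap t z ^ k * compWeight t z := by
  have hsum : Summable fun q : ℕ × ℕ =>
      taylorCoeff f q.2 / ((q.1 : ℂ) + q.2 + 1) * z ^ q.1 := by
    have hg := summable_geometric_of_lt_one (norm_nonneg z) (mem_disc.1 hz)
    refine Summable.of_norm_bounded (hg.mul_of_nonneg hs (fun _ => by positivity)
      (fun _ => by positivity)) fun q => ?_
    rw [norm_mul, norm_pow, mul_comm]
    exact mul_le_mul_of_nonneg_left (norm_taylorCoeff_div_le f q.1 q.2) (by positivity)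
  calc hilbertOp f z
      = ∑' n : ℕ, ∑' k : ℕ, taylorCoeff f k / ((n : ℂ) + k + 1) * z ^ n := by
        unfold hilbertOp hilbertCoeff
        simp_rw [tsum_mul_right]
    _ = ∑' k : ℕ, ∑' n : ℕ, taylorCoeff f k / ((n : ℂ) + k + 1) * z ^ n :=
        (Summable.tsum_comm
          (f := fun n k : ℕ => taylorCoeff f k / ((n : ℂ) + k + 1) * z ^ n) hsum).symm
    _ = _ := by
        refine tsum_congr fun k => ?_
        rw [integral_compMap_pow_mul_compWeight hz, ← (hasSum_pow_div hz k).tsum_eq,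
          ← tsum_mul_left]
        exact tsum_congr fun n => by ring

/-- The decay 1/(k+1) matches the summability of |a_k|/(k+1) and so permits exchanging the sum over
k with the integral. -/
theorem integral_norm_compMap_pow_le {z : ℂ} (hz : z ∈ disc) (k : ℕ) :
    ∫ t in Ioo (0 : ℝ) 1, ‖compMap t z ^ k * compWeight t z‖ ≤
      (1 - ‖z‖)⁻¹ * (1 - ‖z‖)⁻¹ / (k + 1) := by
  have hz' := mem_disc.1 hz
  have hz1 : 0 < 1 - ‖z‖ := by linarith
  have hz0 := norm_nonneg z
  have hc : ContinuousOn (fun t => ‖compMap t z ^ k * compWeight t z‖) (Icc 0 1) :=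
    (((continuousOn_compMap hz).pow k).mul (continuousOn_compWeight hz)).norm
  calc ∫ t in Ioo (0 : ℝ) 1, ‖compMap t z ^ k * compWeight t z‖
      ≤ ∫ t in Ioo (0 : ℝ) 1, (‖z‖ + (1 - ‖z‖) * t) ^ k * (1 - ‖z‖)⁻¹ := by
        refine setIntegral_mono_on (hc.integrableOn_Icc.mono_set Ioo_subset_Icc_self)
          ((by fun_prop : Continuous fun t : ℝ =>
            (‖z‖ + (1 - ‖z‖) * t) ^ k * (1 - ‖z‖)⁻¹).integrableOn_Icc.mono_set
              Ioo_subset_Icc_self) measurableSet_Ioo fun t ht => ?_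
        rw [norm_mul, norm_pow]
        have := ht.1.le
        gcongr
        · exact norm_compMap_le ht.1.le ht.2.le hz
        · exact norm_compWeight_le ht.1.le ht.2.le hz
    _ = (1 - ‖z‖)⁻¹ * ((1 - ‖z‖ ^ (k + 1)) / (k + 1)) * (1 - ‖z‖)⁻¹ := by
        rw [integral_mul_const, ← integral_Ioc_eq_integral_Ioo,
          ← intervalIntegral.integral_of_le zero_le_one,
          intervalIntegral.integral_comp_add_mul (fun x : ℝ => x ^ k) hz1.ne' ‖z‖, integral_pow]
        simp
    _ ≤ _ := by
        rw [mul_right_comm, ← mul_div_assoc]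
        have h1 : 1 - ‖z‖ ^ (k + 1) ≤ 1 := by linarith [pow_nonneg hz0 (k + 1)]
        exact div_le_div_of_nonneg_right (mul_le_of_le_one_right (by positivity) h1)
          (by positivity)

theorem tsum_taylorCoeff_mul_pow (hf : DifferentiableOn ℂ f disc) {w : ℂ} (hw : w ∈ disc) :
    ∑' k : ℕ, taylorCoeff f k * w ^ k = f w := by
  have := Complex.taylorSeries_eq_on_ball' hw hf
  rw [← this]
  refine tsum_congr fun k => ?_
  rw [taylorCoeff, sub_zero]
  ring

/-- The Hilbert matrix operator as an average of weighted composition operators. -/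
theorem hilbertOp_eq_integral (hf : DifferentiableOn ℂ f disc)
    (hs : Summable fun k : ℕ => ‖taylorCoeff f k‖ / (k + 1)) {z : ℂ} (hz : z ∈ disc) :
    hilbertOp f z = ∫ t in Ioo (0 : ℝ) 1, f (compMap t z) * compWeight t z := by
  rw [hilbertOp_eq_tsum_integral hs hz]
  have hint : ∀ k : ℕ, IntegrableOn
      (fun t => taylorCoeff f k * (compMap t z ^ k * compWeight t z)) (Ioo 0 1) := fun k =>
    ((((continuousOn_compMap hz).pow k).mul
      (continuousOn_compWeight hz)).integrableOn_Icc.mono_set Ioo_subset_Icc_self).const_mul _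
  have hsum : Summable fun k : ℕ => ∫ t in Ioo (0 : ℝ) 1,
      ‖taylorCoeff f k * (compMap t z ^ k * compWeight t z)‖ := by
    refine Summable.of_nonneg_of_le (fun k => integral_nonneg fun _ => norm_nonneg _) (fun k => ?_)
      (hs.mul_left ((1 - ‖z‖)⁻¹ * (1 - ‖z‖)⁻¹))
    simp_rw [norm_mul (taylorCoeff f k)]
    rw [integral_const_mul]
    refine (mul_le_mul_of_nonneg_left (integral_norm_compMap_pow_le hz k)
      (norm_nonneg _)).trans (le_of_eq ?_)
    ring
  have h := (hasSum_integral_of_summable_integral_norm hint hsum).tsum_eq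
  simp_rw [integral_const_mul, ← integral_Ioc_eq_integral_Ioo] at h
  simp_rw [intervalIntegral.integral_of_le (zero_le_one (α := ℝ))]
  rw [h, integral_Ioc_eq_integral_Ioo]
  refine setIntegral_congr_fun measurableSet_Ioo fun t ht => ?_
  simp_rw [← mul_assoc, tsum_mul_right]
  rw [tsum_taylorCoeff_mul_pow hf (compMap_mem_disc ht.1.le ht.2 hz)]

end

/-! ### The upper bound -/

theorem det_complex_smul_one (c : ℂ) : (c • (1 : ℂ →L[ℝ] ℂ)).det = ‖c‖ ^ 2 := by
  have e : ((c • (1 : ℂ →L[ℝ] ℂ) : ℂ →L[ℝ] ℂ) : ℂ →ₗ[ℝ] ℂ) = Algebra.lmul ℝ ℂ c := by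
    ext
    simp
  rw [ContinuousLinearMap.det, e, ← Complex.normSq_eq_norm_sq, ← Algebra.norm_complex_apply,
    Algebra.norm_apply]

theorem hasDerivAt_compMap {t : ℝ} (h0 : 0 ≤ t) (h1 : t ≤ 1) {z : ℂ} (hz : z ∈ disc) :
    HasDerivAt (compMap t) ((t * (1 - t) : ℝ) * compWeight t z ^ 2) z := by
  have hd := denom_ne_zero h0 h1 hz
  have := (hasDerivAt_const z (t : ℂ)).div
    (((hasDerivAt_id z).const_mul ((t : ℂ) - 1)).add_const 1) hd
  convert! this using 1
  rw [compWeight]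
  push_cast
  simp only [id]
  field_simp
  ring

theorem compMap_eq_mul (t : ℝ) (z : ℂ) : compMap t z = t * compWeight t z := by
  rw [compMap, compWeight, mul_one_div]

theorem injOn_compMap {t : ℝ} (h0 : 0 < t) (h1 : t < 1) : InjOn (compMap t) disc := by
  intro z hz w hw h
  have hz' := denom_ne_zero h0.le h1.le hz
  have hw' := denom_ne_zero h0.le h1.le hw
  have ht : (t : ℂ) ≠ 0 := by exact_mod_cast h0.ne'
  have ht1 : (t : ℂ) - 1 ≠ 0 := by
    rw [sub_ne_zero]; exact_mod_cast h1.ne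
  rw [compMap, compMap, div_eq_div_iff hz' hw', mul_right_inj' ht, add_left_inj,
    mul_right_inj' ht1] at h
  exact h.symm

/-- The denominator has modulus below 2-t on the disc. The omitted central disc is what keeps the
singular factor |w|^(p-4) under control. -/
theorem lt_norm_compMap {t : ℝ} (h0 : 0 < t) (h1 : t < 1) {z : ℂ} (hz : z ∈ disc) :
    t / (2 - t) < ‖compMap t z‖ := by
  have hd := norm_pos_iff.2 (denom_ne_zero h0.le h1.le hz)
  rw [compMap, norm_div, Complex.norm_real, Real.norm_of_nonneg h0.le]
  refine div_lt_div_of_pos_left h0 hd ?_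
  have h := norm_add_le (((t : ℂ) - 1) * z) 1
  have e : ‖((t : ℂ) - 1) * z‖ = (1 - t) * ‖z‖ := by
    rw [norm_mul, ← norm_neg, neg_sub, ← Complex.ofReal_one, ← Complex.ofReal_sub,
      Complex.norm_real, Real.norm_of_nonneg (by linarith)]
  rw [e, norm_one] at h
  have := mem_disc.1 hz
  nlinarith

/-- Change of variables in a weighted composition operator. -/
theorem lintegral_comp_compMap_le {p t : ℝ} (h0 : 0 < t) (h1 : t < 1) (G : ℂ → ℝ≥0∞) :
    ∫⁻ z in disc, ENNReal.ofReal (‖compWeight t z‖ ^ p) * G (compMap t z) ≤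
      ENNReal.ofReal (t ^ (2 - p) * (1 - t) ^ (-2 : ℝ)) * ∫⁻ w in disc,
        (Ioi (t / (2 - t))).indicator (fun r => ENNReal.ofReal (r ^ (p - 4))) ‖w‖ * G w := by
  have h1t : 0 < 1 - t := by linarith
  -- The Jacobian of φ_t is t²(1-t)²|w_t|⁴ and |w_t| = |w|/t, so |w_t|^p dz becomes t^(2-p)
  -- (1-t)^(-2) |w|^(p-4) dw.
  set Φ : ℂ → ℝ≥0∞ := fun w => ENNReal.ofReal (t ^ (2 - p) * (1 - t) ^ (-2 : ℝ)) *
    ((Ioi (t / (2 - t))).indicator (fun r => ENNReal.ofReal (r ^ (p - 4))) ‖w‖ * G w) with hΦ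
  have hcv := lintegral_image_eq_lintegral_abs_det_fderiv_mul volume measurableSet_disc
    (fun z hz => (hasDerivAt_compMap h0.le h1.le hz).complexToReal_fderiv.hasFDerivWithinAt)
    (injOn_compMap h0 h1) Φ
  have himg : compMap t '' disc ⊆ disc := by
    rintro _ ⟨z, hz, rfl⟩
    exact compMap_mem_disc h0.le h1 hz
  rw [← lintegral_const_mul' _ _ ENNReal.ofReal_ne_top]
  refine le_trans (le_of_eq ?_) (lintegral_mono_set himg)
  rw [hcv]
  refine setLIntegral_congr_fun measurableSet_disc fun z hz => ?_
  have hw : 0 < ‖compWeight t z‖ := by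
    rw [compWeight, norm_div, norm_one]
    exact one_div_pos.2 (norm_pos_iff.2 (denom_ne_zero h0.le h1.le hz))
  simp only [hΦ]
  rw [indicator_of_mem (mem_Ioi.2 (lt_norm_compMap h0 h1 hz)), ← mul_assoc, ← mul_assoc,
    ← ENNReal.ofReal_mul (by positivity), det_complex_smul_one, ← ENNReal.ofReal_mul (by positivity)]
  congr 2
  rw [abs_of_nonneg (by positivity), compMap_eq_mul, norm_mul, norm_mul, norm_pow,
    Complex.norm_real, Complex.norm_real, Real.norm_of_nonneg h0.le,
    Real.norm_of_nonneg (by positivity), Real.mul_rpow h0.le hw.le]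
  set x := ‖compWeight t z‖
  have e1 : t ^ (2 - p) * t ^ (p - 4) = (t ^ 2)⁻¹ := by
    rw [← Real.rpow_add h0, show 2 - p + (p - 4) = -(2 : ℝ) by ring, Real.rpow_neg h0.le,
      Real.rpow_two]
  have e2 : x ^ p = x ^ (p - 4) * x ^ 4 := by
    rw [← Real.rpow_add_natCast hw.ne']; norm_num
  have e3 : (1 - t) ^ (-2 : ℝ) = ((1 - t) ^ 2)⁻¹ := by
    rw [Real.rpow_neg h1t.le, Real.rpow_two]
  calc x ^ p = x ^ (p - 4) * x ^ 4 := e2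
    _ = (t * (1 - t) * x ^ 2) ^ 2 * ((t ^ 2)⁻¹ * ((1 - t) ^ 2)⁻¹ * x ^ (p - 4)) := by
        field_simp
    _ = _ := by rw [← e1, ← e3]; ring

/-- Hölder's inequality for u = (g^(-(p-1)/p) u) · g^((p-1)/p). -/
theorem lintegral_rpow_le_weighted {p : ℝ} (hp : 1 < p) {g : ℝ → ℝ} (hg : Measurable g)
    (hg0 : ∀ t ∈ Ioo (0 : ℝ) 1, 0 < g t) {u : ℝ → ℝ≥0∞}
    (hu : AEMeasurable u (volume.restrict (Ioo 0 1))) :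
    (∫⁻ t in Ioo (0 : ℝ) 1, u t) ^ p ≤ (∫⁻ t in Ioo (0 : ℝ) 1, ENNReal.ofReal (g t)) ^ (p - 1) *
      ∫⁻ t in Ioo (0 : ℝ) 1, ENNReal.ofReal (g t ^ (1 - p)) * u t ^ p := by
  have hp0 : 0 < p := by linarith
  have hp1 : p - 1 ≠ 0 := by linarith
  have hq : p.HolderConjugate (p / (p - 1)) := Real.HolderConjugate.conjExponent hp
  have h := ENNReal.lintegral_mul_le_Lp_mul_Lq (volume.restrict (Ioo (0 : ℝ) 1)) hq
    (f := fun t => ENNReal.ofReal (g t ^ ((1 - p) / p)) * u t)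
    (g := fun t => ENNReal.ofReal (g t ^ ((p - 1) / p)))
    (AEMeasurable.mul (by fun_prop) hu) (by fun_prop)
  have e1 : ∫⁻ t in Ioo (0 : ℝ) 1, u t = ∫⁻ t in Ioo (0 : ℝ) 1,
      ((fun t => ENNReal.ofReal (g t ^ ((1 - p) / p)) * u t) *
        fun t => ENNReal.ofReal (g t ^ ((p - 1) / p))) t := by
    refine setLIntegral_congr_fun measurableSet_Ioo fun t ht => ?_
    simp only [Pi.mul_apply]
    rw [mul_right_comm, ← ENNReal.ofReal_mul (Real.rpow_nonneg (hg0 t ht).le _),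
      ← Real.rpow_add (hg0 t ht), show (1 - p) / p + (p - 1) / p = 0 by ring, Real.rpow_zero]
    simp
  have e2 : ∫⁻ t in Ioo (0 : ℝ) 1, (ENNReal.ofReal (g t ^ ((1 - p) / p)) * u t) ^ p =
      ∫⁻ t in Ioo (0 : ℝ) 1, ENNReal.ofReal (g t ^ (1 - p)) * u t ^ p := by
    refine setLIntegral_congr_fun measurableSet_Ioo fun t ht => ?_
    rw [ENNReal.mul_rpow_of_nonneg _ _ hp0.le,
      ENNReal.ofReal_rpow_of_nonneg (Real.rpow_nonneg (hg0 t ht).le _) hp0.le,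
      ← Real.rpow_mul (hg0 t ht).le, div_mul_cancel₀ _ hp0.ne']
  have e3 : ∫⁻ t in Ioo (0 : ℝ) 1, (ENNReal.ofReal (g t ^ ((p - 1) / p))) ^ (p / (p - 1)) =
      ∫⁻ t in Ioo (0 : ℝ) 1, ENNReal.ofReal (g t) := by
    refine setLIntegral_congr_fun measurableSet_Ioo fun t ht => ?_
    rw [ENNReal.ofReal_rpow_of_nonneg (Real.rpow_nonneg (hg0 t ht).le _)
        (div_nonneg hp0.le (by linarith)),
      ← Real.rpow_mul (hg0 t ht).le, show (p - 1) / p * (p / (p - 1)) = 1 by field_simp,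
      Real.rpow_one]
  rw [← e1, e2, e3] at h
  refine (ENNReal.rpow_le_rpow h hp0.le).trans (le_of_eq ?_)
  rw [ENNReal.mul_rpow_of_nonneg _ _ hp0.le, ← ENNReal.rpow_mul, ← ENNReal.rpow_mul, mul_comm,
    one_div_mul_cancel hp0.ne', ENNReal.rpow_one, show 1 / (p / (p - 1)) * p = p - 1 by field_simp]

/-- The factor from the change of variables is exactly the p-th power of `betaWeight (2/p)`. This
makes it the right Hölder density: the weight reproduces itself. -/
theorem betaWeight_rpow {p t : ℝ} (hp : 0 < p) (h0 : 0 < t) (h1 : t < 1) :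
    betaWeight (2 / p) t ^ (1 - p) * (t ^ (2 - p) * (1 - t) ^ (-2 : ℝ)) = betaWeight (2 / p) t := by
  have h1t : 0 < 1 - t := by linarith
  have e : t ^ (2 - p) * (1 - t) ^ (-2 : ℝ) = betaWeight (2 / p) t ^ p := by
    rw [betaWeight, Real.mul_rpow (by positivity) (by positivity), ← Real.rpow_mul h0.le,
      ← Real.rpow_mul h1t.le]
    congr 2 <;> field_simp
  rw [e, ← Real.rpow_add (betaWeight_pos h0 h1), sub_add_cancel, Real.rpow_one]

theorem lintegral_betaWeight {α : ℝ} (h0 : 0 < α) (h1 : α < 1) :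
    ∫⁻ t in Ioo (0 : ℝ) 1, ENNReal.ofReal (betaWeight α t) = ENNReal.ofReal (betaMass α) := by
  rw [← integral_betaWeight h0 h1, ofReal_integral_eq_lintegral_ofReal
    (integrableOn_betaWeight h0 h1) ((ae_restrict_iff' measurableSet_Ioo).2
      (.of_forall fun t ht => (betaWeight_pos ht.1 ht.2).le))]

theorem measurable_compWeight_uncurry : Measurable fun q : ℂ × ℝ => compWeight q.2 q.1 := by
  unfold compWeight; fun_prop

theorem measurable_compMap_uncurry : Measurable fun q : ℂ × ℝ => compMap q.2 q.1 := by
  unfold compMap; fun_prop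

/-- Pointwise Hölder estimate for the Hilbert matrix operator. -/
theorem ofReal_norm_hilbertOp_rpow_le {p : ℝ} (hp : 2 < p) {f : ℂ → ℂ} (hf : MemBergman p f)
    {z : ℂ} (hz : z ∈ disc) :
    ENNReal.ofReal (‖hilbertOp f z‖ ^ p) ≤
      ENNReal.ofReal (betaMass (2 / p)) ^ (p - 1) * ∫⁻ t in Ioo (0 : ℝ) 1,
        ENNReal.ofReal (betaWeight (2 / p) t ^ (1 - p)) *
          (ENNReal.ofReal (‖compWeight t z‖ ^ p) *
            ENNReal.ofReal (disc.indicator (fun w => ‖f w‖ ^ p) (compMap t z))) := by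
  have hp0 : 0 < p := by linarith
  have hα0 : 0 < 2 / p := by positivity
  have hα1 : 2 / p < 1 := by rw [div_lt_one hp0]; exact hp
  have hmaps : MapsTo (fun t => compMap t z) (Ioo 0 1) disc := fun t ht =>
    compMap_mem_disc ht.1.le ht.2 hz
  have hcont : ContinuousOn (fun t => f (compMap t z) * compWeight t z) (Ioo 0 1) :=
    (hf.differentiableOn.continuousOn.comp ((continuousOn_compMap hz).mono Ioo_subset_Icc_self)
      hmaps).mul ((continuousOn_compWeight hz).mono Ioo_subset_Icc_self)
  have hu : AEMeasurable (fun t => ‖f (compMap t z) * compWeight t z‖ₑ)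
      (volume.restrict (Ioo 0 1)) := (hcont.aemeasurable measurableSet_Ioo).enorm
  have h1 : ‖hilbertOp f z‖ₑ ≤ ∫⁻ t in Ioo (0 : ℝ) 1, ‖f (compMap t z) * compWeight t z‖ₑ := by
    rw [hilbertOp_eq_integral hf.differentiableOn (summable_norm_taylorCoeff_div hp hf) hz]
    exact enorm_integral_le_lintegral_enorm _
  have hen : ∀ w : ℂ, ‖w‖ₑ ^ p = ENNReal.ofReal (‖w‖ ^ p) := fun w => by
    rw [← ofReal_norm, ENNReal.ofReal_rpow_of_nonneg (norm_nonneg _) hp0.le]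
  have h2 := lintegral_rpow_le_weighted (p := p) (by linarith) (measurable_betaWeight (2 / p))
    (fun t ht => betaWeight_pos ht.1 ht.2) hu
  rw [lintegral_betaWeight hα0 hα1] at h2
  rw [← hen]
  refine (ENNReal.rpow_le_rpow h1 hp0.le).trans (h2.trans (le_of_eq ?_))
  congr 1
  refine setLIntegral_congr_fun measurableSet_Ioo fun t ht => ?_
  rw [hen, norm_mul, Real.mul_rpow (norm_nonneg _) (norm_nonneg _),
    indicator_of_mem (hmaps ht), ← ENNReal.ofReal_mul (by positivity : 0 ≤ ‖compWeight t z‖ ^ p),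
    mul_comm (‖f _‖ ^ p)]

theorem lintegral_hilbertOp_le {p : ℝ} (hp2 : 2 < p) (hp4 : p < 4) {f : ℂ → ℂ}
    (hf : MemBergman p f) :
    ∫⁻ z in disc, ENNReal.ofReal (‖hilbertOp f z‖ ^ p) ≤
      ENNReal.ofReal (betaMass (2 / p)) ^ p * ∫⁻ z in disc, ENNReal.ofReal (‖f z‖ ^ p) := by
  have hp0 : 0 < p := by linarith
  have hα0 : 0 < 2 / p := by positivity
  have hα1 : 2 / p < 1 := by rw [div_lt_one hp0]; exact hp2
  have hfc := hf.differentiableOn.continuousOn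
  set B := ENNReal.ofReal (betaMass (2 / p)) with hB
  have hBpos : B ≠ 0 := by simpa [hB] using betaMass_pos hα0 hα1
  set g := betaWeight (2 / p) with hg
  set G : ℂ → ℝ≥0∞ := fun w => ENNReal.ofReal (disc.indicator (fun w => ‖f w‖ ^ p) w) with hG
  have hGm : Measurable G := (measurable_indicator_of_continuousOn measurableSet_disc
    (hfc.norm.rpow_const fun _ _ => Or.inr hp0.le)).ennreal_ofReal
  set W : ℝ → ℝ≥0∞ := fun r => ENNReal.ofReal (r ^ (p - 4)) *
    ∫⁻ t in Ioo (0 : ℝ) 1, (Ioi (t / (2 - t))).indicator (fun _ => ENNReal.ofReal (g t)) r with hW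
  have hind : Measurable fun q : ℝ × ℝ =>
      (Ioi (q.2 / (2 - q.2))).indicator (fun _ => ENNReal.ofReal (g q.2)) q.1 := by
    have : Measurable ({q : ℝ × ℝ | q.2 / (2 - q.2) < q.1}.indicator
        fun q => ENNReal.ofReal (g q.2)) :=
      ((measurable_betaWeight (2 / p)).comp measurable_snd).ennreal_ofReal.indicator
        (measurableSet_lt (by fun_prop) (by fun_prop))
    exact this
  have hWm : Measurable W :=
    Measurable.mul (by fun_prop) (Measurable.lintegral_prod_right' hind)
  have hm1 : Measurable fun q : ℂ × ℝ => ENNReal.ofReal (g q.2 ^ (1 - p)) *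
      (ENNReal.ofReal (‖compWeight q.2 q.1‖ ^ p) * G (compMap q.2 q.1)) :=
    (((measurable_betaWeight (2 / p)).comp measurable_snd).pow_const _).ennreal_ofReal.mul
      ((measurable_compWeight_uncurry.norm.pow_const _).ennreal_ofReal.mul
        (hGm.comp measurable_compMap_uncurry))
  have hm2 : Measurable fun q : ℝ × ℂ => ENNReal.ofReal (‖q.2‖ ^ (p - 4)) *
      (Ioi (q.1 / (2 - q.1))).indicator (fun _ => ENNReal.ofReal (g q.1)) ‖q.2‖ * G q.2 :=
    (Measurable.mul (by fun_prop) (hind.comp (measurable_snd.norm.prodMk measurable_fst))).mul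
      (hGm.comp measurable_snd)
  calc ∫⁻ z in disc, ENNReal.ofReal (‖hilbertOp f z‖ ^ p)
      ≤ ∫⁻ z in disc, B ^ (p - 1) * ∫⁻ t in Ioo (0 : ℝ) 1, ENNReal.ofReal (g t ^ (1 - p)) *
          (ENNReal.ofReal (‖compWeight t z‖ ^ p) * G (compMap t z)) :=
        setLIntegral_mono' measurableSet_disc fun z hz => ofReal_norm_hilbertOp_rpow_le hp2 hf hz
    _ = B ^ (p - 1) * ∫⁻ t in Ioo (0 : ℝ) 1, ENNReal.ofReal (g t ^ (1 - p)) * ∫⁻ z in disc,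
          ENNReal.ofReal (‖compWeight t z‖ ^ p) * G (compMap t z) := by
        rw [lintegral_const_mul _ hm1.lintegral_prod_right',
          lintegral_lintegral_swap hm1.aemeasurable]
        simp_rw [lintegral_const_mul' _ _ ENNReal.ofReal_ne_top]
    _ ≤ B ^ (p - 1) * ∫⁻ t in Ioo (0 : ℝ) 1, ∫⁻ w in disc, ENNReal.ofReal (‖w‖ ^ (p - 4)) *
          (Ioi (t / (2 - t))).indicator (fun _ => ENNReal.ofReal (g t)) ‖w‖ * G w := by
        refine mul_le_mul' le_rfl (setLIntegral_mono' measurableSet_Ioo fun t ht => ?_)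
        refine (mul_le_mul' le_rfl (lintegral_comp_compMap_le ht.1 ht.2 G)).trans (le_of_eq ?_)
        rw [← mul_assoc, ← ENNReal.ofReal_mul (Real.rpow_nonneg (betaWeight_pos ht.1 ht.2).le _),
          betaWeight_rpow hp0 ht.1 ht.2, ← lintegral_const_mul' _ _ ENNReal.ofReal_ne_top]
        refine lintegral_congr fun w => ?_
        rw [← mul_assoc]
        congr 1
        by_cases h : t / (2 - t) < ‖w‖
        · rw [indicator_of_mem (mem_Ioi.2 h), indicator_of_mem (mem_Ioi.2 h), mul_comm]
        · rw [indicator_of_notMem (by simpa using h), indicator_of_notMem (by simpa using h),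
            mul_zero, mul_zero]
    _ = B ^ (p - 1) * ∫⁻ w in disc, W ‖w‖ * ENNReal.ofReal (‖f w‖ ^ p) := by
        rw [lintegral_lintegral_swap hm2.aemeasurable]
        congr 1
        refine setLIntegral_congr_fun measurableSet_disc fun w hw => ?_
        simp only [hG, indicator_of_mem hw, hW]
        rw [lintegral_mul_const' _ _ ENNReal.ofReal_ne_top,
          lintegral_const_mul' _ _ ENNReal.ofReal_ne_top]
    _ = B ^ (p - 1) * ∫⁻ r in Ioo (0 : ℝ) 1, ENNReal.ofReal (r ^ (p - 3) * cumBeta (2 / p) r) *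
          ENNReal.ofReal (circleMean p f r) := by
        rw [setLIntegral_disc_mul_radial hp0.le hfc hWm]
        congr 1
        refine setLIntegral_congr_fun measurableSet_Ioo fun r hr => ?_
        simp only [hW]
        rw [← ofReal_cumBeta hα0 hα1 hr, ← mul_assoc, ← ENNReal.ofReal_mul hr.1.le,
          ← ENNReal.ofReal_mul (mul_nonneg hr.1.le (Real.rpow_nonneg hr.1.le _))]
        congr 3
        rw [show p - 3 = p - 4 + 1 by ring, Real.rpow_add_one hr.1.ne', mul_comm]
    _ ≤ B ^ (p - 1) * (B * ∫⁻ r in Ioo (0 : ℝ) 1, ENNReal.ofReal r *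
          ENNReal.ofReal (circleMean p f r)) := by
        refine mul_le_mul' le_rfl (lintegral_rpow_mul_cumBeta_mul_le hp2 hp4 ?_ fun _ _ =>
          ENNReal.ofReal_ne_top)
        exact fun r hr s hs hrs => ENNReal.ofReal_le_ofReal
          (circleMean_mono hp2 hf.differentiableOn hr.1.le hrs hs.2)
    _ = _ := by
        have hpol := setLIntegral_disc_mul_radial hp0.le hfc (W := fun _ => 1) measurable_const
        simp only [one_mul, mul_one] at hpol
        rw [hpol, ← mul_assoc]
        congr 1
        nth_rewrite 2 [← ENNReal.rpow_one B]
        rw [← ENNReal.rpow_add _ _ hBpos ENNReal.ofReal_ne_top, sub_add_cancel]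

theorem memBergman_hilbertOp {p : ℝ} (hp2 : 2 < p) (hp4 : p < 4) {f : ℂ → ℂ}
    (hf : MemBergman p f) : MemBergman p (hilbertOp f) := by
  have hp0 : 0 < p := by linarith
  have hd := differentiableOn_hilbertOp (summable_norm_taylorCoeff_div hp2 hf)
  refine ⟨hd.analyticOnNhd Metric.isOpen_ball, ?_, ?_⟩
  · exact (hd.continuousOn.norm.rpow_const fun _ _ => Or.inr hp0.le).aestronglyMeasurable
      measurableSet_disc
  · rw [hasFiniteIntegral_iff_ofReal (.of_forall fun _ => by positivity)]
    refine (lintegral_hilbertOp_le hp2 hp4 hf).trans_lt (ENNReal.mul_lt_top ?_ ?_)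
    · exact ENNReal.rpow_lt_top_of_nonneg hp0.le ENNReal.ofReal_ne_top
    · rw [← ofReal_integral_bergman hf]
      exact ENNReal.ofReal_lt_top

theorem bergmanNorm_hilbertOp_le {p : ℝ} (hp2 : 2 < p) (hp4 : p < 4) {f : ℂ → ℂ}
    (hf : MemBergman p f) :
    bergmanNorm p (hilbertOp f) ≤ betaMass (2 / p) * bergmanNorm p f := by
  have hp0 : 0 < p := by linarith
  have hB := betaMass_pos (α := 2 / p) (by positivity) (by rw [div_lt_one hp0]; exact hp2)
  have h := lintegral_hilbertOp_le hp2 hp4 hf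
  have hJ : 0 ≤ ∫ z in disc, ‖f z‖ ^ p := integral_nonneg fun _ => by positivity
  rw [← ofReal_integral_bergman hf, ← ofReal_integral_bergman (memBergman_hilbertOp hp2 hp4 hf),
    ENNReal.ofReal_rpow_of_pos hB, ← ENNReal.ofReal_mul (by positivity),
    ENNReal.ofReal_le_ofReal_iff (by positivity)] at h
  have e : betaMass (2 / p) = (betaMass (2 / p) ^ p) ^ (1 / p) := by
    rw [← Real.rpow_mul hB.le, mul_one_div_cancel hp0.ne', Real.rpow_one]
  rw [bergmanNorm, bergmanNorm, e, ← Real.mul_rpow (by positivity) (by positivity)]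
  refine Real.rpow_le_rpow (mul_nonneg (by positivity) (integral_nonneg fun _ => by positivity))
    ?_ (by positivity)
  rw [mul_left_comm]
  exact mul_le_mul_of_nonneg_left h (by positivity)

/-! ### The lower bound -/

/-- The test function `(1 - z) ^ (-γ)`. -/
noncomputable def powTest (γ : ℝ) (z : ℂ) : ℂ := (1 - z) ^ ((-γ : ℝ) : ℂ)

theorem one_sub_mem_slitPlane {z : ℂ} (hz : z ∈ disc) : 0 < (1 - z).re := by
  have := (Complex.re_le_norm z).trans_lt (mem_disc.1 hz)
  rw [Complex.sub_re, Complex.one_re]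
  linarith

theorem one_sub_ne_zero {z : ℂ} (hz : z ∈ disc) : 1 - z ≠ 0 := fun h => by
  have := one_sub_mem_slitPlane hz
  simp [h] at this

theorem norm_powTest_rpow (p γ : ℝ) (z : ℂ) : ‖powTest γ z‖ ^ p = ‖1 - z‖ ^ (-(γ * p)) := by
  rw [powTest, Complex.norm_cpow_real, ← Real.rpow_mul (norm_nonneg _), neg_mul]

theorem differentiableOn_powTest (γ : ℝ) : DifferentiableOn ℂ (powTest γ) disc := by
  intro z hz
  refine DifferentiableWithinAt.cpow (by fun_prop) (by fun_prop) ?_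
  exact Or.inl (one_sub_mem_slitPlane hz)

/-- The only singularity is at 1, and s is below the real dimension 2. The substitution z ↦ 1-z
carries the disc into the closed ball of radius 2 about 0. -/
theorem integrableOn_norm_one_sub_rpow {s : ℝ} (hs : s < 2) :
    IntegrableOn (fun z : ℂ => ‖1 - z‖ ^ (-s)) disc := by
  have hloc : LocallyIntegrable (fun w : ℂ => ‖w‖ ^ (-s)) volume := by
    refine locallyIntegrable_of_norm_le_rpow (C := 1) (α := s) (by simp) (by simpa using hs)
      (.of_forall fun w => ?_) (measurable_norm.pow_const _).aestronglyMeasurable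
    rw [Real.norm_of_nonneg (by positivity), one_mul]
  have hb : IntegrableOn (fun w : ℂ => ‖w‖ ^ (-s)) (Metric.closedBall 0 2) :=
    hloc.integrableOn_isCompact (isCompact_closedBall _ _)
  have hb' := ((Measure.measurePreserving_sub_left volume (1 : ℂ)).integrableOn_comp_preimage
    (Homeomorph.subLeft (1 : ℂ)).measurableEmbedding).2 hb
  refine IntegrableOn.mono_set hb' fun z hz => ?_
  rw [mem_preimage, mem_closedBall_zero_iff]
  have h1 := norm_sub_le 1 z
  have h2 := mem_disc.1 hz
  rw [norm_one] at h1
  linarith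

theorem memBergman_powTest {p γ : ℝ} (h : γ * p < 2) : MemBergman p (powTest γ) := by
  refine ⟨(differentiableOn_powTest γ).analyticOnNhd Metric.isOpen_ball, ?_⟩
  simp_rw [norm_powTest_rpow]
  exact integrableOn_norm_one_sub_rpow h

/-- The norms of the test functions blow up as `γ * p` increases to `2`. -/
theorem le_integral_norm_one_sub_rpow {s : ℝ} (hs : s < 2) :
    2 / (2 - s) ≤ ∫ z in disc, ‖1 - z‖ ^ (-s) := by
  have hnn : 0 ≤ ∫ z in disc, ‖1 - z‖ ^ (-s) := integral_nonneg fun _ => by positivity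
  rw [← ENNReal.ofReal_le_ofReal_iff hnn, ofReal_integral_eq_lintegral_ofReal
    (integrableOn_norm_one_sub_rpow hs) (.of_forall fun _ => by positivity),
    ← lintegral_indicator measurableSet_disc,
    ← lintegral_sub_left_eq_self _ (1 : ℂ), ← Complex.lintegral_comp_polarCoord_symm]
  -- In polar coordinates about 1, the sector r < 1, |θ| < 1 lies in the disc: cos θ ≥ 1/2 gives 1 -
  -- 2r cos θ + r² < 1.
  have hsub : Ioo (0 : ℝ) 1 ×ˢ Ioo (-1 : ℝ) 1 ⊆ polarCoord.target := by
    rw [polarCoord_target]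
    refine prod_mono (fun r hr => hr.1) (Ioo_subset_Ioo ?_ ?_) <;> linarith [Real.pi_gt_three]
  refine le_trans ?_ (lintegral_mono_set hsub)
  have hpt : ∀ q ∈ Ioo (0 : ℝ) 1 ×ˢ Ioo (-1 : ℝ) 1, ENNReal.ofReal (q.1 ^ ((2 - s) - 1)) ≤
      ENNReal.ofReal q.1 • disc.indicator (fun z => ENNReal.ofReal (‖1 - z‖ ^ (-s)))
        (1 - Complex.polarCoord.symm q) := by
    rintro ⟨r, θ⟩ ⟨hr, hθ⟩
    simp only at hr hθ
    have hcos : 1 / 2 ≤ Real.cos θ := by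
      have := Real.one_sub_sq_div_two_le_cos (x := θ)
      nlinarith [hθ.1, hθ.2]
    have hmem : 1 - Complex.polarCoord.symm (r, θ) ∈ disc := by
      rw [mem_disc, ← sq_lt_one_iff₀ (norm_nonneg _), ← Complex.normSq_eq_norm_sq,
        Complex.normSq_apply, Complex.polarCoord_symm_apply]
      simp [-Complex.ofReal_cos, -Complex.ofReal_sin]
      have hexp : (1 - r * Real.cos θ) * (1 - r * Real.cos θ) + r * Real.sin θ * (r * Real.sin θ) =
          1 - 2 * r * Real.cos θ + r ^ 2 := by
        linear_combination r ^ 2 * Real.sin_sq_add_cos_sq θ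
      rw [hexp]
      nlinarith [mul_pos hr.1 (sub_pos.2 hr.2), mul_le_mul_of_nonneg_left hcos hr.1.le]
    rw [indicator_of_mem hmem, sub_sub_cancel, Complex.norm_polarCoord_symm, smul_eq_mul,
      ← ENNReal.ofReal_mul hr.1.le, abs_of_pos hr.1]
    refine ENNReal.ofReal_le_ofReal (le_of_eq ?_)
    rw [show 2 - s - 1 = -s + 1 by ring, Real.rpow_add_one hr.1.ne', mul_comm]
  refine le_trans (le_of_eq ?_) (setLIntegral_mono' (measurableSet_Ioo.prod measurableSet_Ioo) hpt)
  rw [Measure.volume_eq_prod, setLIntegral_prod _ (by fun_prop)]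
  simp only [setLIntegral_const, Real.volume_Ioo]
  rw [lintegral_mul_const' _ _ ENNReal.ofReal_ne_top,
    lintegral_rpow_Ioo (by linarith) ⟨le_rfl, one_pos⟩, Real.zero_rpow (by linarith), sub_zero,
    ← ENNReal.ofReal_mul (by
      have : 0 < 2 - s := by linarith
      positivity)]
  congr 1
  ring

/-- The factor by which the Hilbert matrix operator multiplies `powTest γ`. -/
noncomputable def powFactor (γ : ℝ) (z : ℂ) : ℂ :=
  ∫ t in Ioo (0 : ℝ) 1, ((1 - t : ℝ) : ℂ) ^ ((-γ : ℝ) : ℂ) *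
    (((t : ℂ) - 1) * z + 1) ^ ((γ - 1 : ℝ) : ℂ)

theorem re_denom_pos {t : ℝ} (h0 : 0 ≤ t) (h1 : t ≤ 1) {z : ℂ} (hz : z ∈ disc) :
    0 < (((t : ℂ) - 1) * z + 1).re := by
  have h2 := one_sub_mem_slitPlane hz
  simp only [Complex.sub_re, Complex.one_re, Complex.add_re, Complex.mul_re, Complex.ofReal_re,
    Complex.sub_im, Complex.ofReal_im, Complex.one_im, sub_zero, zero_mul] at h2 ⊢
  rcases h0.eq_or_lt with rfl | h0
  · linarith
  · nlinarith

/-- Follows from 1 - φ_t(z) = (1-t)(1-z)/D with D = (t-1)z+1. -/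
theorem powTest_compMap_mul {γ t : ℝ} (h0 : 0 ≤ t) (h1 : t < 1) {z : ℂ} (hz : z ∈ disc) :
    powTest γ (compMap t z) * compWeight t z =
      powTest γ z * (((1 - t : ℝ) : ℂ) ^ ((-γ : ℝ) : ℂ) *
        (((t : ℂ) - 1) * z + 1) ^ ((γ - 1 : ℝ) : ℂ)) := by
  have hd := denom_ne_zero h0 h1.le hz
  have hdr := re_denom_pos h0 h1.le hz
  have hz1 := one_sub_ne_zero hz
  have hzr := one_sub_mem_slitPlane hz
  set D := ((t : ℂ) - 1) * z + 1 with hD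
  have e1 : 1 - compMap t z = ((1 - t : ℝ) : ℂ) * ((1 - z) * D⁻¹) := by
    rw [compMap, ← hD]
    field_simp
    rw [hD]; push_cast; ring
  have hDarg : D.arg ≠ Real.pi := by
    intro h
    have := Complex.abs_arg_lt_pi_div_two_iff.2 (Or.inl hdr)
    rw [h, abs_of_pos Real.pi_pos] at this
    linarith [Real.pi_pos]
  -- 1-z and D both lie in the right half-plane, so the arguments differ by less than π and
  -- principal logarithms subtract exactly.
  have hlog : Complex.log ((1 - z) * D⁻¹) = Complex.log (1 - z) - Complex.log D := by
    rw [(Complex.log_mul_eq_add_log_iff hz1 (inv_ne_zero hd)).2, Complex.log_inv _ hDarg,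
      ← sub_eq_add_neg]
    rw [Complex.arg_inv, if_neg hDarg]
    have h1 := abs_lt.1 (Complex.abs_arg_lt_pi_div_two_iff.2 (Or.inl hzr))
    have h2 := abs_lt.1 (Complex.abs_arg_lt_pi_div_two_iff.2 (Or.inl hdr))
    constructor <;> linarith [h1.1, h1.2, h2.1, h2.2]
  have h1t : 0 < 1 - t := by linarith
  have hx0 : (1 - z) * D⁻¹ ≠ 0 := mul_ne_zero hz1 (inv_ne_zero hd)
  have ht0 : ((1 - t : ℝ) : ℂ) ≠ 0 := by exact_mod_cast h1t.ne'
  have hDinv : compWeight t z = Complex.exp (-Complex.log D) := by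
    rw [Complex.exp_neg, Complex.exp_log hd, compWeight, ← hD, one_div]
  rw [powTest, e1, powTest, hDinv, Complex.cpow_def_of_ne_zero (mul_ne_zero ht0 hx0),
    Complex.cpow_def_of_ne_zero hz1, Complex.cpow_def_of_ne_zero ht0,
    Complex.cpow_def_of_ne_zero hd, Complex.log_ofReal_mul h1t hx0, hlog, Complex.ofReal_log h1t.le,
    ← Complex.exp_add, ← Complex.exp_add, ← Complex.exp_add]
  congr 1
  push_cast
  ring

theorem hilbertOp_powTest {p γ : ℝ} (hp : 2 < p) (h : γ * p < 2) {z : ℂ} (hz : z ∈ disc) :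
    hilbertOp (powTest γ) z = powTest γ z * powFactor γ z := by
  have hm := memBergman_powTest h
  rw [hilbertOp_eq_integral hm.differentiableOn (summable_norm_taylorCoeff_div hp hm) hz,
    powFactor, ← integral_const_mul]
  exact setIntegral_congr_fun measurableSet_Ioo fun t ht => powTest_compMap_mul ht.1.le ht.2 hz

theorem le_norm_denom {t : ℝ} (h1 : t ≤ 1) {z : ℂ} (hz : z ∈ disc) :
    t ≤ ‖((t : ℂ) - 1) * z + 1‖ := by
  have := one_sub_le_norm_denom h1 z
  have := mem_disc.1 hz
  nlinarith

/-- At z = 1 the denominator reduces to t and the integrand to `betaWeight α`. Dominated convergence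
applies since |(t-1)z+1| ≥ t uniformly on the disc and γ stays in (α/2, α). -/
theorem tendsto_powFactor {α : ℝ} (h0 : 0 < α) (h1 : α < 1) :
    Tendsto (fun q : ℝ × ℂ => powFactor q.1 q.2) (𝓝[<] α ×ˢ 𝓝[disc] 1) (𝓝 (betaMass α : ℂ)) := by
  have hB : (betaMass α : ℂ) = ∫ t in Ioo (0 : ℝ) 1, (betaWeight α t : ℂ) := by
    rw [← integral_betaWeight h0 h1, integral_complex_ofReal]
  rw [hB]
  unfold powFactor
  have hγ : ∀ᶠ q : ℝ × ℂ in 𝓝[<] α ×ˢ 𝓝[disc] 1, q.1 ∈ Ioo (α / 2) α :=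
    tendsto_fst.eventually (Ioo_mem_nhdsLT (by linarith))
  have hz : ∀ᶠ q : ℝ × ℂ in 𝓝[<] α ×ˢ 𝓝[disc] 1, q.2 ∈ disc :=
    tendsto_snd.eventually self_mem_nhdsWithin
  refine tendsto_integral_filter_of_dominated_convergence
    (fun t => t ^ (α / 2 - 1) * (1 - t) ^ (1 - α - 1)) ?_ ?_
    (integrableOn_rpow_mul_one_sub_rpow (by linarith) (by linarith)) ?_
  · filter_upwards [hz] with q hq
    refine ContinuousOn.aestronglyMeasurable (fun t ht => ?_) measurableSet_Ioo
    refine ContinuousAt.continuousWithinAt (ContinuousAt.mul ?_ ?_)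
    · refine ContinuousAt.cpow (by fun_prop) continuousAt_const (Or.inl ?_)
      rw [Complex.ofReal_re]; linarith [ht.2]
    · exact ContinuousAt.cpow (by fun_prop) continuousAt_const (Or.inl (re_denom_pos ht.1.le ht.2.le hq))
  · filter_upwards [hz, hγ] with q hq hqγ
    refine (ae_restrict_iff' measurableSet_Ioo).2 (.of_forall fun t ht => ?_)
    have h1t : 0 < 1 - t := by linarith [ht.2]
    rw [norm_mul, Complex.norm_cpow_real, Complex.norm_cpow_real, Complex.norm_real,
      Real.norm_of_nonneg h1t.le, mul_comm]
    refine mul_le_mul ?_ ?_ (by positivity) (Real.rpow_nonneg ht.1.le _)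
    · refine (Real.rpow_le_rpow_of_nonpos ht.1 (le_norm_denom ht.2.le hq)
        (by linarith [hqγ.2])).trans ?_
      exact Real.rpow_le_rpow_of_exponent_ge ht.1 ht.2.le (by linarith [hqγ.1])
    · exact Real.rpow_le_rpow_of_exponent_ge h1t (by linarith [ht.1]) (by linarith [hqγ.2])
  · refine (ae_restrict_iff' measurableSet_Ioo).2 (.of_forall fun t ht => ?_)
    have h1t : 0 < 1 - t := by linarith [ht.2]
    have hlim : (betaWeight α t : ℂ) = ((1 - t : ℝ) : ℂ) ^ ((-α : ℝ) : ℂ) *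
        (((t : ℂ) - 1) * 1 + 1) ^ ((α - 1 : ℝ) : ℂ) := by
      rw [mul_one, sub_add_cancel, ← Complex.ofReal_cpow h1t.le, ← Complex.ofReal_cpow ht.1.le,
        ← Complex.ofReal_mul, betaWeight, mul_comm]
    rw [hlim]
    have hc : ContinuousAt (fun q : ℝ × ℂ => ((1 - t : ℝ) : ℂ) ^ ((-q.1 : ℝ) : ℂ) *
        (((t : ℂ) - 1) * q.2 + 1) ^ ((q.1 - 1 : ℝ) : ℂ)) (α, 1) := by
      refine ContinuousAt.mul ?_ ?_
      · refine ContinuousAt.const_cpow (by fun_prop) (Or.inl ?_)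
        exact_mod_cast h1t.ne'
      · refine ContinuousAt.cpow (by fun_prop) (by fun_prop) (Or.inl ?_)
        simpa using ht.1
    refine hc.tendsto.mono_left ?_
    rw [nhds_prod_eq]
    exact Filter.prod_mono nhdsWithin_le_nhds nhdsWithin_le_nhds

theorem integral_rpow_le_of_bergmanNorm_le {p C : ℝ} (hp : 0 < p) (hC : 0 ≤ C) {f g : ℂ → ℂ}
    (h : bergmanNorm p g ≤ C * bergmanNorm p f) :
    ∫ z in disc, ‖g z‖ ^ p ≤ C ^ p * ∫ z in disc, ‖f z‖ ^ p := by
  have hf : 0 ≤ Real.pi⁻¹ * ∫ z in disc, ‖f z‖ ^ p :=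
    mul_nonneg (by positivity) (integral_nonneg fun _ => by positivity)
  have hg : 0 ≤ Real.pi⁻¹ * ∫ z in disc, ‖g z‖ ^ p :=
    mul_nonneg (by positivity) (integral_nonneg fun _ => by positivity)
  unfold bergmanNorm at h
  have h2 := Real.rpow_le_rpow (Real.rpow_nonneg hg _) h hp.le
  rw [Real.mul_rpow hC (Real.rpow_nonneg hf _), ← Real.rpow_mul hf,
    ← Real.rpow_mul hg, one_div_mul_cancel hp.ne', Real.rpow_one, Real.rpow_one,
    mul_left_comm] at h2
  exact le_of_mul_le_mul_left h2 (by positivity)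

/-- If C < c < B, the image of the test function dominates c times it near z = 1, while elsewhere
the test function has bounded mass. Hence (c^p - C^p) times the diverging total mass would stay
bounded. -/
theorem betaMass_le_of_bergmanNorm_le {p : ℝ} (hp2 : 2 < p) (hp4 : p < 4) {C : ℝ} (hC : 0 ≤ C)
    (h : ∀ f : ℂ → ℂ, MemBergman p f → bergmanNorm p (hilbertOp f) ≤ C * bergmanNorm p f) :
    betaMass (2 / p) ≤ C := by
  have hp0 : 0 < p := by linarith
  have hα0 : 0 < 2 / p := by positivity
  have hα1 : 2 / p < 1 := by rw [div_lt_one hp0]; exact hp2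
  set α := 2 / p with hα
  by_contra! hlt
  obtain ⟨c, hCc, hcB⟩ := exists_between hlt
  have hc0 : 0 < c := hC.trans_lt hCc
  have hev : ∀ᶠ q : ℝ × ℂ in 𝓝[<] α ×ˢ 𝓝[disc] 1, c < ‖powFactor q.1 q.2‖ := by
    refine (tendsto_powFactor hα0 hα1).norm.eventually (lt_mem_nhds ?_)
    rwa [Complex.norm_real, Real.norm_of_nonneg (betaMass_pos hα0 hα1).le]
  obtain ⟨P, hP, Q, hQ, hPQ⟩ := eventually_prod_iff.1 hev
  obtain ⟨δ₀, hδ₀, hδQ⟩ := Metric.mem_nhdsWithin_iff.1 hQ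
  -- δ ≤ 1 gives δ^(-γp) ≤ δ^(-2), a bound away from 1 independent of γ.
  set δ := min δ₀ 1 with hδ
  have hδpos : 0 < δ := lt_min hδ₀ one_pos
  have hCp : C ^ p < c ^ p := Real.rpow_lt_rpow hC hCc hp0
  set K := c ^ p * (volume.real disc * δ ^ (-2 : ℝ)) with hK
  have hK0 : 0 ≤ K := by positivity
  -- for every admissible exponent the mass of the test function is bounded
  have hbound : ∀ γ, 0 < γ → γ < α → P γ → (c ^ p - C ^ p) * (2 / (2 - γ * p)) ≤ K := by
    intro γ hγ0 hγα hPγ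
    have hs : γ * p < 2 := by rwa [hα, lt_div_iff₀ hp0] at hγα
    set J := ∫ z in disc, ‖1 - z‖ ^ (-(γ * p)) with hJ
    have hJi := integrableOn_norm_one_sub_rpow hs
    have hJ2 : 2 / (2 - γ * p) ≤ J := le_integral_norm_one_sub_rpow hs
    have hm := memBergman_powTest hs
    have h1 := integral_rpow_le_of_bergmanNorm_le hp0 hC (h _ hm)
    simp_rw [norm_powTest_rpow] at h1
    rw [← hJ] at h1
    have h2 : c ^ p * J - K ≤ ∫ z in disc, ‖hilbertOp (powTest γ) z‖ ^ p := by
      have e : c ^ p * J - K =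
          ∫ z in disc, (c ^ p * ‖1 - z‖ ^ (-(γ * p)) - c ^ p * δ ^ (-2 : ℝ)) := by
        rw [integral_sub (hJi.const_mul _) (by
          refine integrableOn_const ?_
          exact measure_ball_lt_top.ne), integral_const_mul, setIntegral_const, hK, smul_eq_mul]
        ring
      rw [e]
      refine setIntegral_mono_on ?_ (memBergman_hilbertOp hp2 hp4 hm).2 measurableSet_disc
        fun z hz => ?_
      · exact (hJi.const_mul _).sub (integrableOn_const measure_ball_lt_top.ne)
      rw [hilbertOp_powTest hp2 hs hz, norm_mul, Real.mul_rpow (norm_nonneg _) (norm_nonneg _),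
        norm_powTest_rpow]
      have hx : 0 ≤ ‖1 - z‖ ^ (-(γ * p)) := by positivity
      -- Near 1 the multiplier exceeds c; away from 1 the subtracted constant makes the left side
      -- nonpositive.
      rcases lt_or_ge ‖1 - z‖ δ with hzδ | hzδ
      · have hQz : Q z := hδQ ⟨by
          rw [Metric.mem_ball, dist_comm, Complex.dist_eq]
          exact hzδ.trans_le (min_le_left _ _), hz⟩
        have := Real.rpow_le_rpow hc0.le (hPQ hPγ hQz).le hp0.le
        have h3 : 0 ≤ c ^ p * δ ^ (-2 : ℝ) := by positivity
        nlinarith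
      · have h3 : ‖1 - z‖ ^ (-(γ * p)) ≤ δ ^ (-2 : ℝ) :=
          (Real.rpow_le_rpow_of_nonpos hδpos hzδ (by nlinarith)).trans
            (Real.rpow_le_rpow_of_exponent_ge hδpos (min_le_right _ _) (by linarith))
        have h4 : c ^ p * ‖1 - z‖ ^ (-(γ * p)) ≤ c ^ p * δ ^ (-2 : ℝ) :=
          mul_le_mul_of_nonneg_left h3 (by positivity)
        have h5 : 0 ≤ ‖1 - z‖ ^ (-(γ * p)) * ‖powFactor γ z‖ ^ p := by positivity
        linarith
    have h3 := mul_le_mul_of_nonneg_left hJ2 (sub_nonneg.2 hCp.le)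
    linarith
  have hlim : Tendsto (fun γ => (c ^ p - C ^ p) * (2 / (2 - γ * p))) (𝓝[<] α) atTop := by
    have h1 : Tendsto (fun γ => 2 - γ * p) (𝓝[<] α) (𝓝[>] 0) := by
      refine tendsto_nhdsWithin_iff.2 ⟨?_, ?_⟩
      · have hc : ContinuousAt (fun γ : ℝ => 2 - γ * p) α := by fun_prop
        have := hc.tendsto
        rw [show 2 - α * p = 0 by rw [hα]; field_simp; ring] at this
        exact this.mono_left nhdsWithin_le_nhds
      · filter_upwards [self_mem_nhdsWithin] with γ hγ
        have : γ < 2 / p := hγ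
        rw [lt_div_iff₀ hp0] at this
        exact sub_pos.2 this
    have h2 := (tendsto_inv_nhdsGT_zero.comp h1).const_mul_atTop
      (mul_pos (sub_pos.2 hCp) two_pos)
    refine h2.congr fun γ => ?_
    simp only [Function.comp_apply]
    ring
  have h0ev : ∀ᶠ γ in 𝓝[<] α, 0 < γ :=
    mem_of_superset (Ioo_mem_nhdsLT hα0) fun γ hγ => hγ.1
  have hαev : ∀ᶠ γ in 𝓝[<] α, γ < α := self_mem_nhdsWithin
  obtain ⟨γ, hγP, hγ0, hγα, hγK⟩ :=
    (hP.and (h0ev.and (hαev.and (hlim.eventually_gt_atTop K)))).exists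
  exact (hbound γ hγ0 hγα hγP).not_gt hγK

/-! ### The norm of the Hilbert matrix operator -/

/-- For `2 < p < 4` the Hilbert matrix operator is well defined on the Bergman space `A^p`, maps it
into itself, and its operator norm (the least constant `C` with `‖H f‖ ≤ C ‖f‖` for all `f` in
`A^p`) equals `π / sin (2 π / p)`. -/
theorem theorem3p4 (p : ℝ) (hp2 : 2 < p) (hp4 : p < 4) :
    (∀ f : ℂ → ℂ, MemBergman p f →
      (∀ n : ℕ, Summable fun k : ℕ => taylorCoeff f k / ((n : ℂ) + (k : ℂ) + 1)) ∧
      (∀ z ∈ disc, Summable fun n : ℕ => hilbertCoeff f n * z ^ n) ∧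
      MemBergman p (hilbertOp f)) ∧
    IsLeast {C : ℝ | 0 ≤ C ∧
        ∀ f : ℂ → ℂ, MemBergman p f → bergmanNorm p (hilbertOp f) ≤ C * bergmanNorm p f}
      (Real.pi / Real.sin (2 * Real.pi / p)) := by
  have hp0 : 0 < p := by linarith
  have hB : Real.pi / Real.sin (2 * Real.pi / p) = betaMass (2 / p) := by
    rw [betaMass]; congr 2; ring
  refine ⟨fun f hf => ?_, ?_⟩
  · have hs := summable_norm_taylorCoeff_div hp2 hf
    exact ⟨summable_hilbertCoeff_terms hs, fun z hz => summable_hilbertCoeff_mul_pow hs hz,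
      memBergman_hilbertOp hp2 hp4 hf⟩
  · rw [hB]
    have hpos : 0 < betaMass (2 / p) :=
      betaMass_pos (by positivity) (by rw [div_lt_one hp0]; exact hp2)
    exact ⟨⟨hpos.le, fun f hf => bergmanNorm_hilbertOp_le hp2 hp4 hf⟩,
      fun C hC => betaMass_le_of_bergmanNorm_le hp2 hp4 hC.1 hC.2⟩
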